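/- Notation. Let $K$ be an ordered field (for instance $\mathbb{R}$ or $\mathbb{Q}$), $n\ge 1$, $[n]=\{1,\dots,n\}$. For $M\in K^{n\times n}$ and $\alpha\subseteq[n]$ let $M_{\alpha\alpha}$ be the principal submatrix with rows and columns in $\alpha$, and for $x\in K^n$ let $\operatorname{psupp}(x)=\{j: x_j>0\}$. For an invertible matrix $A$, a vector $x$ and an index $i$ such that column $i$ of $A^{-1}$ has a positive entry, put $$\theta_i(A,x)=\min_{j:\,A^{-1}_{ji}>0}\frac{x_j}{A^{-1}_{ji}},\qquad \mathrm{reduce}_i(A,x)=x-\theta_i(A,x)\,A^{-1}e_i .$$ The procedure $\mathrm{RecursiveFind}(M,\alpha,x)$, for $\alpha\subseteq[n]$ and $x\in K^\alpha$ with $x>0$ and $M_{\alpha\alpha}x\le 0$, is: if $|\alpha|=1$ or $\det M_{\alpha\alpha}\le 0$, return $\alpha$. Otherwise, if $\det M_{\alpha\setminus\{i\},\alpha\setminus\{i\}}\le 0$ for some $i\in\alpha$, return $\alpha\setminus\{i\}$ for the least such $i$. Otherwise let $y^i=\mathrm{reduce}_i(M_{\alpha\alpha},x)$ for $i\in\alpha$,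 let $y=y^{i_*}$ for the least $i_*\in\alpha$ with $y^{i_*}\ne 0$, let $\beta=\operatorname{psupp}(y)$, and return $\mathrm{RecursiveFind}(M,\beta,y_\beta)$. Finally $\mathrm{FindNonpositiveMinor}(M,x)=\mathrm{RecursiveFind}(M,[n],x)$. Theorem. Let $M\in K^{n\times n}$ and $x\in K^n$ with $x_i>0$ and $(Mx)_i\le 0$ for all $i\in[n]$. 1. $\mathrm{FindNonpositiveMinor}(M,x)$ makes at most $n$ nested calls and returns a set $\beta\subseteq[n]$ with $\det(M_{\beta\beta})\le 0$. It computes at most $(1+n)+(1+(n-1))+\dots+(1+1)=n(n+3)/2=O(n^2)$ determinants. 2. In each call that is not answered directly, that is, whenever $|\alpha|\ge 2$, $x\in K^\alpha$, $x>0$, $M_{\alpha\alpha}x\le 0$, $\det M_{\alpha\alpha}>0$ and $\det M_{\alpha\setminus\{i\},\alpha\setminus\{i\}}>0$ for all $i\in\alpha$, every $y^i=\mathrm{reduce}_i(M_{\alpha\alpha},x)$ $(i\in\alpha)$ satisfies $y^i\ge 0$, $M_{\alpha\alpha}y^i\le 0$ and $\operatorname{psupp}(y^i)\subsetneq\alpha$,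 and $y^i\neq 0$ for at least one $i\in\alpha$. 3. The procedure runs in polynomial time. Implement it by a program that computes determinants and inverses by the method of Faddeev and LeVerrier ($N=I$; in round $k$ put $c=-\operatorname{tr}(BN)/k$ and replace $N$ by $BN+cI$). The determinant routine of this program returns the determinant of every square matrix over $K$, and the program returns $\mathrm{FindNonpositiveMinor}(M,x)$. There is a polynomial $p$, the same for all $K$, such that the program executes at most $p(n)$ steps (arithmetic operations, comparisons, loaded constants and bookkeeping steps). There is a polynomial $q$ such that for $K=\mathbb{Q}$ its total bit cost is at most $q(L)$, where $L$ is the sum of the bit lengths of the entries of $M$ and $x$, an operation or comparison on rational numbers (in lowest terms) of bit lengths $s$ and $t$ costs $(s+t)^2$, a loaded constant costs its bit length, and a bookkeeping step costs $1$. -/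

import Mathlib

namespace NonposMinor

/-! ## The recursive procedure, in exact mathematical form -/

section Algorithm

variable {K : Type} [Field K] [LinearOrder K]

/-- The principal submatrix `M_αα`. -/
def principal {n : ℕ} (M : Matrix (Fin n) (Fin n) K) (α : Finset (Fin n)) : Matrix α α K :=
  M.submatrix (fun a => (a : Fin n)) (fun a => (a : Fin n))

/-- The positive support of a vector. -/
def psupp {n : ℕ} (x : Fin n → K) : Finset (Fin n) :=
  Finset.univ.filter fun j => 0 < x j

/-- `θ_i(A, x)`, the minimum of `x j / A⁻¹ j i` over all `j` with `A⁻¹ j i > 0`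
(and `0` if there is no such `j`). -/
noncomputable def theta {ι : Type} [Fintype ι] [DecidableEq ι] (A : Matrix ι ι K) (x : ι → K)
    (i : ι) : K :=
  if h : (Finset.univ.filter fun j => 0 < A⁻¹ j i).Nonempty then
    (Finset.univ.filter fun j => 0 < A⁻¹ j i).inf' h (fun j => x j / A⁻¹ j i)
  else 0

/-- The reduction step `x - θ_i(A, x) A⁻¹ e_i`. -/
noncomputable def reduceStep {ι : Type} [Fintype ι] [DecidableEq ι] (A : Matrix ι ι K)
    (x : ι → K) (i : ι) : ι → K :=
  x - theta A x i • (A⁻¹).mulVec (Pi.single i 1)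

/-- The reduction step at `i ∈ α` for `M_αα` and `x_α`, extended by zero outside `α`. -/
noncomputable def reduceOn {n : ℕ} (M : Matrix (Fin n) (Fin n) K) (α : Finset (Fin n))
    (x : Fin n → K) (i : Fin n) : Fin n → K := fun j =>
  if h : i ∈ α ∧ j ∈ α then
    reduceStep (principal M α) (fun a => x a) ⟨i, h.1⟩ ⟨j, h.2⟩
  else 0

/-- The recursive procedure on `(M, α, x)`. A vector indexed by `α` is kept as a vector on `[n]`
of which only the entries in `α` are used. The first argument bounds the depth of the recursion;
the result `∅` (whose minor is `1`) stands for failure. -/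
noncomputable def recursiveFind {n : ℕ} (M : Matrix (Fin n) (Fin n) K) :
    ℕ → Finset (Fin n) → (Fin n → K) → Finset (Fin n)
  | 0, _, _ => ∅
  | t + 1, α, x =>
    if α.card = 1 ∨ (principal M α).det ≤ 0 then α
    else
      match (List.finRange n).find?
          (fun i => decide (i ∈ α ∧ (principal M (α.erase i)).det ≤ 0)) with
      | some i => α.erase i
      | none =>
        match (List.finRange n).find? (fun i => decide (i ∈ α ∧ reduceOn M α x i ≠ 0)) with
        | some i => recursiveFind M t (psupp (reduceOn M α x i)) (reduceOn M α x i)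
        | none => ∅

/-- The procedure, started on `α = [n]`, with at most `n` nested calls. -/
noncomputable def findNonpositiveMinor {n : ℕ} (M : Matrix (Fin n) (Fin n) K) (x : Fin n → K) :
    Finset (Fin n) :=
  recursiveFind M n Finset.univ x

end Algorithm

/-! ## Programs with a step count

A program has access to numbers (of type `ρ`) only through the instructions below. Programs are
written for an arbitrary `ρ`, so they can neither inspect a number nor compute with numbers
except by executing, and paying for, an instruction. -/

/-- The four arithmetic operations. -/
inductive ArithOp : Type
  | add
  | sub
  | mul
  | div

/-- The instructions; the index is the type of the answer. -/
inductive Instr (ρ : Type) : Type → Type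
  /-- load a natural number constant -/
  | lit (k : ℕ) : Instr ρ ρ
  /-- an arithmetic operation on two numbers -/
  | arith (o : ArithOp) (a b : ρ) : Instr ρ ρ
  /-- the comparison `a ≤ b` -/
  | le (a b : ρ) : Instr ρ Bool
  /-- one step of bookkeeping: an iteration of a loop, a cell of memory written, a call -/
  | tick : Instr ρ Unit
  /-- the same, on entry to the determinant routine -/
  | enterDet : Instr ρ Unit

/-- Programs that use numbers of type `ρ` and return a value of type `α`. -/
inductive Prog (ρ : Type) (α : Type) : Type 1
  | ret (a : α) : Prog ρ α
  | exec {β : Type} (i : Instr ρ β) (next : β → Prog ρ α) : Prog ρ α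

namespace Prog

variable {ρ α β : Type}

/-- Sequential composition. -/
def bind : Prog ρ α → (α → Prog ρ β) → Prog ρ β
  | ret a, f => f a
  | exec i next, f => exec i fun b => bind (next b) f

instance : Monad (Prog ρ) where
  pure := ret
  bind := bind

/-- The program that executes one instruction and returns the answer. -/
def instr (i : Instr ρ α) : Prog ρ α := exec i ret

end Prog

section Semantics

variable {K : Type} [Field K] [LinearOrder K]

/-- The answer to an instruction over the ordered field `K`. -/
def Instr.eval : {β : Type} → Instr K β → β
  | _, .lit k => (k : K)
  | _, .arith .add a b => a + b
  | _, .arith .sub a b => a - b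
  | _, .arith .mul a b => a * b
  | _, .arith .div a b => a / b
  | _, .le a b => decide (a ≤ b)
  | _, .tick => ()
  | _, .enterDet => ()

/-- The value returned by a program. -/
def Prog.run {α : Type} : Prog K α → α
  | .ret a => a
  | .exec i next => (next i.eval).run

/-- The total weight of the instructions executed by a program. -/
def Prog.cost (w : (β : Type) → Instr K β → ℕ) {α : Type} : Prog K α → ℕ
  | .ret _ => 0
  | .exec (β := β) i next => w β i + (next i.eval).cost w

/-- The number of instructions executed. -/
def Prog.steps {α : Type} (P : Prog K α) : ℕ := P.cost fun _ _ => 1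

/-- `1` on entry to the determinant routine, and `0` for every other instruction. -/
def Instr.detWeight : (β : Type) → Instr K β → ℕ
  | _, .enterDet => 1
  | _, _ => 0

/-- The number of determinants computed. -/
def Prog.dets {α : Type} (P : Prog K α) : ℕ := P.cost Instr.detWeight

end Semantics

/-- The bit length of a rational number in lowest terms (one bit is for the sign). -/
def bitLength (r : ℚ) : ℕ := r.num.natAbs.size + r.den.size + 1

/-- The bit cost of an instruction on rational numbers: an operation or comparison on operands
of bit lengths `s` and `t` costs `(s + t) ^ 2`. -/
def Instr.bitWeight : (β : Type) → Instr ℚ β → ℕ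
  | _, .lit k => k.size + 1
  | _, .arith _ a b => (bitLength a + bitLength b) ^ 2
  | _, .le a b => (bitLength a + bitLength b) ^ 2
  | _, .tick => 1
  | _, .enterDet => 1

/-- The bit cost of a program run on rational numbers. -/
def Prog.bitTime {α : Type} (P : Prog ℚ α) : ℕ := P.cost Instr.bitWeight

/-- The total bit length of a rational matrix and a rational vector. -/
def inputLength {n : ℕ} (M : Matrix (Fin n) (Fin n) ℚ) (x : Fin n → ℚ) : ℕ :=
  (∑ i, ∑ j, bitLength (M i j)) + ∑ i, bitLength (x i)

/-! ## The procedure as a program -/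

section Programs

variable {ρ β : Type}

open Prog

/-- Compute `f 0, …, f (k - 1)` in this order and store the results in a table. -/
def tabulate : (k : ℕ) → (Fin k → Prog ρ β) → Prog ρ (Fin k → β)
  | 0, _ => pure Fin.elim0
  | k + 1, f => do
    instr .tick
    let a ← f 0
    let v ← tabulate k fun i => f i.succ
    pure (Fin.cons a v)

/-- Compute the sum of `f 0, …, f (k - 1)`. -/
def sumProg : (k : ℕ) → (Fin k → Prog ρ ρ) → Prog ρ ρ
  | 0, _ => instr (.lit 0)
  | k + 1, f => do
    instr .tick
    let a ← f 0
    let s ← sumProg k fun i => f i.succ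
    instr (.arith .add a s)

/-- Run `f 0, f 1, …` until one of them returns a result. -/
def firstSome : (k : ℕ) → (Fin k → Prog ρ (Option β)) → Prog ρ (Option β)
  | 0, _ => pure none
  | k + 1, f => do
    instr .tick
    let r ← f 0
    match r with
    | some b => pure (some b)
    | none => firstSome k fun i => f i.succ

variable {n : ℕ}

/-- The `n × n` matrix with the block `M_αα` on `α` and the identity on the complement of `α`;
its determinant is that of `M_αα` and its inverse is the inverse of `M_αα`, padded likewise. -/
def padProg (M : Fin n → Fin n → ρ) (α : Finset (Fin n)) : Prog ρ (Fin n → Fin n → ρ) :=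
  tabulate n fun i => tabulate n fun j =>
    if i ∈ α ∧ j ∈ α then pure (M i j)
    else if i = j then instr (.lit 1)
    else instr (.lit 0)

/-- The identity matrix. -/
def identityProg : Prog ρ (Fin n → Fin n → ρ) :=
  tabulate n fun i => tabulate n fun j =>
    if i = j then instr (.lit 1) else instr (.lit 0)

/-- The product of two matrices. -/
def mulProg (A B : Fin n → Fin n → ρ) : Prog ρ (Fin n → Fin n → ρ) :=
  tabulate n fun i => tabulate n fun j =>
    sumProg n fun l => instr (.arith .mul (A i l) (B l j))

/-- The rounds `1, …, m` of the Faddeev–LeVerrier method for a matrix `B`: from `N = 1`, `c = 1`,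
round `k` puts `c = - tr (B N) / k` and then replaces `N` by `B N + c`. -/
def leverrier (B : Fin n → Fin n → ρ) : ℕ → Prog ρ ((Fin n → Fin n → ρ) × ρ)
  | 0 => do
    let N ← identityProg
    let c ← instr (.lit 1)
    pure (N, c)
  | m + 1 => do
    let s ← leverrier B m
    let P ← mulProg B s.1
    let t ← sumProg n fun i => pure (P i i)
    let z ← instr (.lit 0)
    let k ← instr (.lit (m + 1))
    let u ← instr (.arith .sub z t)
    let c ← instr (.arith .div u k)
    let N ← tabulate n fun i => tabulate n fun j =>
      if i = j then instr (.arith .add (P i j) c) else pure (P i j)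
    pure (N, c)

/-- The determinant of `B`, which is `(-1) ^ n c` for the number `c` of round `n`. -/
def detProg (B : Fin n → Fin n → ρ) : Prog ρ ρ := do
  instr .enterDet
  let s ← leverrier B n
  if n % 2 = 0 then pure s.2
  else do
    let z ← instr (.lit 0)
    instr (.arith .sub z s.2)

/-- Column `i` of the inverse of `B`, which is `- N / c` for the matrix `N` of round `n - 1` and
the number `c` of round `n`. -/
def invColProg (B : Fin n → Fin n → ρ) (i : Fin n) : Prog ρ (Fin n → ρ) := do
  let s ← leverrier B (n - 1)
  let r ← leverrier B n
  let z ← instr (.lit 0)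
  let d ← instr (.arith .sub z r.2)
  tabulate n fun j => instr (.arith .div (s.1 j i) d)

/-- The minimum of `x j / b j` over all `j` with `b j > 0`, if there is such a `j`. -/
def minRatioProg : (k : ℕ) → (x b : Fin k → ρ) → Prog ρ (Option ρ)
  | 0, _, _ => pure none
  | k + 1, x, b => do
    instr .tick
    let m ← minRatioProg k (fun j => x j.succ) (fun j => b j.succ)
    let z ← instr (.lit 0)
    let nonpos ← instr (.le (b 0) z)
    if nonpos then pure m
    else do
      let r ← instr (.arith .div (x 0) (b 0))
      match m with
      | none => pure (some r)
      | some s => do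
        let less ← instr (.le r s)
        if less then pure (some r) else pure (some s)

/-- The reduction step at `i ∈ α`, for a vector `x` that vanishes outside `α`. -/
def reduceProg (M : Fin n → Fin n → ρ) (α : Finset (Fin n)) (x : Fin n → ρ) (i : Fin n) :
    Prog ρ (Fin n → ρ) := do
  let B ← padProg M α
  let b ← invColProg B i
  let m ← minRatioProg n x b
  let θ ← match m with
    | some s => pure s
    | none => instr (.lit 0)
  tabulate n fun j => do
    let p ← instr (.arith .mul θ (b j))
    instr (.arith .sub (x j) p)

/-- Whether `y` has a nonzero entry. -/
def nonzeroProg (y : Fin n → ρ) : Prog ρ Bool := do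
  let r ← firstSome n fun j => do
    let z ← instr (.lit 0)
    let p ← instr (.le (y j) z)
    let q ← instr (.le z (y j))
    if p && q then pure none else pure (some ())
  pure r.isSome

/-- The positive support of `y`. -/
def psuppProg (y : Fin n → ρ) : Prog ρ (Finset (Fin n)) := do
  let v ← tabulate n fun j => do
    let z ← instr (.lit 0)
    instr (.le (y j) z)
  pure (Finset.univ.filter fun j => v j = false)

/-- `n` steps of bookkeeping, for an operation on a subset of `[n]` stored as `n` bits. -/
def scanProg (n : ℕ) : Prog ρ Unit := do
  let _ ← tabulate n fun _ => (pure () : Prog ρ Unit)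
  pure ()

/-- Whether `det M_αα ≤ 0`. -/
def minorNonposProg (M : Fin n → Fin n → ρ) (α : Finset (Fin n)) : Prog ρ Bool := do
  let B ← padProg M α
  let d ← detProg B
  let z ← instr (.lit 0)
  instr (.le d z)

/-- The recursive procedure as a program. -/
def recursiveFindProg (M : Fin n → Fin n → ρ) :
    ℕ → Finset (Fin n) → (Fin n → ρ) → Prog ρ (Finset (Fin n))
  | 0, _, _ => pure ∅
  | t + 1, α, x => do
    scanProg n
    if α.card = 1 then pure α
    else do
      let b ← minorNonposProg M α
      if b then pure α
      else do
        let r ← firstSome n fun i =>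
          if i ∈ α then do
            scanProg n
            let c ← minorNonposProg M (α.erase i)
            if c then pure (some (α.erase i)) else pure none
          else pure none
        match r with
        | some γ => pure γ
        | none => do
          let s ← firstSome n fun i =>
            if i ∈ α then do
              let y ← reduceProg M α x i
              let c ← nonzeroProg y
              if c then pure (some y) else pure none
            else pure none
          match s with
          | some y => do
            let γ ← psuppProg y
            recursiveFindProg M t γ y
          | none => pure ∅

/-- The whole procedure as a program with input `M` and `x`. -/
def findNonpositiveMinorProg (M : Fin n → Fin n → ρ) (x : Fin n → ρ) : Prog ρ (Finset (Fin n)) :=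
  recursiveFindProg M n Finset.univ x

end Programs

end NonposMinor

/-! Write A for the block on α. If det A and all minors of size one less are positive, Cramer's rule
makes every diagonal entry of the inverse of A positive, so θ_i is a genuine minimum. With y = x -
θ_i A⁻¹ e_i, the choice of θ_i keeps y ≥ 0 and kills at least one coordinate, and A y = A x - θ_i
e_i ≤ 0. Hence the support shrinks and the hypotheses pass to the block on it. If every y were zero,
A x would be a multiple of two different unit vectors, so A x = 0 and θ_i = 0, whence x = y = 0, a
contradiction. On a single index a, M_aa x_a ≤ 0 and x_a > 0 give M_aa ≤ 0. A call on α computes at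
most 1 + |α| determinants, which sums to n(n+3)/2. This is carried by `Admissible.reduceOn`,
`Admissible.exists_reduceOn_ne_zero` and `recursiveFind_spec`.

The Faddeev–LeVerrier rounds compute the coefficients of the adjugate of X - B and of the
characteristic polynomial χ: the recursion comes from (X - B) adj(X - B) = χ, and the trace formula
from χ' = tr adj(X - B) (`leverrier_eq`). Only 1, …, n are divided by, which are nonzero in an
ordered field.

For the bit cost, all numbers of these rounds have a denominator dividing D^n n! and absolute value
at most (2n²H)^n, where D is a common denominator of M and H bounds its entries. The vectors are the
delicate point: bounding each operation separately would multiply the bit length in every call. But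
y_j = x_j - x_k (u_j / u_k) for a column u of numbers in that box, and the u_j / u_k share a small
denominator, so each call adds a fixed number e + 1 of bits (`VecBound.sub_div_mul`). The bit cost
is then at most the number of steps times the largest weight of an instruction. -/

namespace NonposMinor

/-! ### Semantics of sequential composition -/

namespace Prog

section Basics

variable {ρ α β : Type}

@[simp] theorem bind_eq (P : Prog ρ α) (f : α → Prog ρ β) : P >>= f = P.bind f := rfl

@[simp] theorem pure_eq (a : α) : (pure a : Prog ρ α) = ret a := rfl

end Basics

section Semantics

variable {K : Type} [Field K] [LinearOrder K] {α β : Type}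

@[simp] theorem run_ret (a : α) : (ret a : Prog K α).run = a := rfl

@[simp] theorem run_instr (i : Instr K α) : (instr i).run = i.eval := rfl

@[simp] theorem run_bind (P : Prog K α) (f : α → Prog K β) :
    (P.bind f).run = (f P.run).run := by
  induction P with
  | ret a => rfl
  | exec i next ih => exact ih _

variable (w : (β : Type) → Instr K β → ℕ)

@[simp] theorem cost_ret (a : α) : (ret a : Prog K α).cost w = 0 := rfl

@[simp] theorem cost_instr (i : Instr K α) : (instr i).cost w = w α i := rfl

@[simp] theorem cost_bind (P : Prog K α) (f : α → Prog K β) :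
    (P.bind f).cost w = P.cost w + (f P.run).cost w := by
  induction P with
  | ret a => simp [Prog.bind]
  | exec i next ih => simp [Prog.bind, Prog.cost, Prog.run, ih, add_assoc]

/-- Every instruction executed by the program satisfies `S`. -/
def All (S : (β : Type) → Instr K β → Prop) {α : Type} : Prog K α → Prop
  | .ret _ => True
  | .exec (β := β) i next => S β i ∧ (next i.eval).All S

variable (S : (β : Type) → Instr K β → Prop)

@[simp] theorem all_ret (a : α) : (ret a : Prog K α).All S := trivial

@[simp] theorem all_instr (i : Instr K α) : (instr i).All S ↔ S α i := by
  simp [instr, All]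

@[simp] theorem all_bind (P : Prog K α) (f : α → Prog K β) :
    (P.bind f).All S ↔ P.All S ∧ (f P.run).All S := by
  induction P with
  | ret a => simp [Prog.bind]
  | exec i next ih => simp [Prog.bind, All, Prog.run, ih, and_assoc]

variable {w S}

/-- Separates the two halves of the bit bound: counting steps, and bounding the numbers that occur.
-/
theorem cost_le_steps_mul {W : ℕ} (hW : ∀ β i, S β i → w β i ≤ W) (P : Prog K α) (hP : P.All S) :
    P.cost w ≤ P.steps * W := by
  induction P with
  | ret a => simp [steps]
  | exec i next ih =>
    have h1 := hW _ _ hP.1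
    have h2 := ih _ hP.2
    simp only [steps, cost] at h2 ⊢
    rw [add_mul, one_mul]
    exact add_le_add h1 h2

end Semantics

end Prog

open Prog

/-! ### Loops: value, cost and operands -/

section Combinators

variable {K : Type} [Field K] [LinearOrder K] {β : Type}
  (w : (β : Type) → Instr K β → ℕ) {S : (β : Type) → Instr K β → Prop}

@[simp] theorem run_tabulate (k : ℕ) (f : Fin k → Prog K β) :
    (tabulate k f).run = fun i => (f i).run := by
  induction k with
  | zero => exact Subsingleton.elim _ _
  | succ k ih =>
    funext i
    simp only [tabulate, bind_eq, pure_eq, run_bind, run_ret, ih]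
    refine Fin.cases ?_ (fun j => ?_) i <;> simp

@[simp] theorem cost_tabulate (k : ℕ) (f : Fin k → Prog K β) :
    (tabulate k f).cost w = ∑ i, (w Unit .tick + (f i).cost w) := by
  induction k with
  | zero => simp [tabulate]
  | succ k ih =>
    simp only [tabulate, bind_eq, pure_eq, cost_bind, cost_instr, cost_ret, ih, Fin.sum_univ_succ]
    ring

theorem all_tabulate (ht : S Unit .tick) (k : ℕ) (f : Fin k → Prog K β)
    (h : ∀ i, (f i).All S) : (tabulate k f).All S := by
  induction k with
  | zero => simp [tabulate]
  | succ k ih => simp [tabulate, ht, h, ih]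

@[simp] theorem run_sumProg (k : ℕ) (f : Fin k → Prog K K) :
    (sumProg k f).run = ∑ i, (f i).run := by
  induction k with
  | zero => simp [sumProg, Instr.eval]
  | succ k ih => simp [sumProg, Instr.eval, ih, Fin.sum_univ_succ]

@[simp] theorem cost_sumProg_one (k : ℕ) (f : Fin k → Prog K K) :
    (sumProg k f).cost (fun _ _ => 1) = 1 + ∑ i, (2 + (f i).cost fun _ _ => 1) := by
  induction k with
  | zero => simp [sumProg]
  | succ k ih =>
    simp only [sumProg, bind_eq, cost_bind, cost_instr, ih, Fin.sum_univ_succ]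
    ring

@[simp] theorem dets_sumProg (k : ℕ) (f : Fin k → Prog K K) :
    (sumProg k f).cost Instr.detWeight = ∑ i, (f i).cost Instr.detWeight := by
  induction k with
  | zero => simp [sumProg, Instr.detWeight]
  | succ k ih => simp [sumProg, Instr.detWeight, ih, Fin.sum_univ_succ]

/-- Every sum computed by `sumProg` is a sum over a subset of the summands. -/
theorem all_sumProg (ht : S Unit .tick) (hz : S K (.lit 0)) (k : ℕ) (f : Fin k → Prog K K)
    (h : ∀ i, (f i).All S)
    (hs : ∀ (i : Fin k) (T : Finset (Fin k)), S K (.arith .add (f i).run (∑ j ∈ T, (f j).run))) :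
    (sumProg k f).All S := by
  induction k with
  | zero => simpa [sumProg] using hz
  | succ k ih =>
    -- The last addition has the sum over the shifted indices as its second operand. Allowing
    -- arbitrary subsets T in the hypothesis makes it stable under this shift.
    have h1 := hs 0 (Finset.univ.map (Fin.succEmb k))
    have h2 := ih (fun i => f i.succ) (fun i => h i.succ) fun i T => by
      simpa using hs i.succ (T.map (Fin.succEmb k))
    simp only [Finset.sum_map, Fin.coe_succEmb] at h1
    simp [sumProg, ht, h, h2, h1]

theorem run_firstSome (k : ℕ) (f : Fin k → Prog K (Option β)) :
    (firstSome k f).run = (List.finRange k).findSome? fun i => (f i).run := by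
  induction k with
  | zero => simp [firstSome]
  | succ k ih =>
    rw [List.finRange_succ, List.findSome?_cons]
    simp only [firstSome, bind_eq, pure_eq, run_bind, List.findSome?_map]
    cases h : (f 0).run <;> simp [Function.comp_def, ih]

theorem cost_firstSome_le (k : ℕ) (f : Fin k → Prog K (Option β)) :
    (firstSome k f).cost w ≤ ∑ i, (w Unit .tick + (f i).cost w) := by
  induction k with
  | zero => simp [firstSome]
  | succ k ih =>
    simp only [firstSome, bind_eq, pure_eq, cost_bind, cost_instr, Fin.sum_univ_succ]
    have := ih fun i => f i.succ
    cases h : (f 0).run <;> simp only [cost_ret] <;> omega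

theorem all_firstSome (ht : S Unit .tick) (k : ℕ) (f : Fin k → Prog K (Option β))
    (h : ∀ i, (f i).All S) : (firstSome k f).All S := by
  induction k with
  | zero => simp [firstSome]
  | succ k ih =>
    have := ih (fun i => f i.succ) fun i => h i.succ
    simp only [firstSome, bind_eq, pure_eq, all_bind, all_instr]
    refine ⟨ht, h 0, ?_⟩
    cases h : (f 0).run <;> simp [this]

end Combinators

/-! ### The adjugate of the characteristic matrix -/

section FaddeevLeVerrier

open Polynomial Matrix

variable {ι R : Type} [Fintype ι] [DecidableEq ι] [CommRing R]

/-- The derivative of the characteristic polynomial is the trace of the adjugate of the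
characteristic matrix. -/
theorem derivative_charpoly_eq_trace_adjugate (B : Matrix ι ι R) :
    derivative B.charpoly = (adjugate (charmatrix B)).trace := by
  -- The derivative of X - B is the identity. So replacing column i by the i-th unit vector in the
  -- Leibniz expansion amounts to differentiating the i-th factor, and summing over i is the product
  -- rule.
  have hdiag (i : ι) : adjugate (charmatrix B) i i =
      ∑ σ : Equiv.Perm ι, Equiv.Perm.sign σ •
        ((∏ j ∈ Finset.univ.erase i, charmatrix B (σ j) j) *
          derivative (charmatrix B (σ i) i)) := by
    rw [← transpose_apply (adjugate _), adjugate_transpose, adjugate_apply, updateRow_transpose,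
      det_transpose, det_apply]
    refine Finset.sum_congr rfl fun σ _ => congrArg _ ?_
    rw [← Finset.prod_erase_mul _ _ (Finset.mem_univ i)]
    congr 1
    · refine Finset.prod_congr rfl fun j hj => ?_
      rw [updateCol_ne (Finset.ne_of_mem_erase hj)]
    · by_cases h : σ i = i <;> simp [h]
  rw [Matrix.charpoly, det_apply, derivative_sum]
  simp only [Matrix.trace, diag_apply, hdiag]
  rw [Finset.sum_comm]
  refine Finset.sum_congr rfl fun σ _ => ?_
  rw [← Finset.smul_sum, ← derivative_prod_finset]
  simp [Units.smul_def]

/-- The coefficients of `X` times the adjugate of the characteristic matrix. -/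
noncomputable def adjugateCoeff (B : Matrix ι ι R) (k : ℕ) : Matrix ι ι R :=
  (X * matPolyEquiv (adjugate (charmatrix B))).coeff k

/-- Compare coefficients in (X - B) adj(X - B) = χ. The extra factor X in `adjugateCoeff` makes the
recursion valid at k = 0 as well. -/
theorem adjugateCoeff_eq (B : Matrix ι ι R) (k : ℕ) :
    adjugateCoeff B k = B * adjugateCoeff B (k + 1) + scalar ι (B.charpoly.coeff k) := by
  have h : charmatrix B * adjugate (charmatrix B) = B.charpoly • 1 := mul_adjugate _
  apply_fun matPolyEquiv at h
  rw [map_mul, matPolyEquiv_charmatrix, matPolyEquiv_smul_one] at h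
  have := congrArg (fun p => p.coeff k) h
  simp only [sub_mul, coeff_sub, coeff_C_mul, coeff_map] at this
  rw [adjugateCoeff, adjugateCoeff, coeff_X_mul, ← sub_eq_iff_eq_add', this]
  rfl

theorem trace_adjugateCoeff (B : Matrix ι ι R) (k : ℕ) :
    (adjugateCoeff B k).trace = k * B.charpoly.coeff k := by
  cases k with
  | zero => simp [adjugateCoeff]
  | succ k =>
    have := congrArg (fun p => p.coeff k) (derivative_charpoly_eq_trace_adjugate B)
    simp only [coeff_derivative, Matrix.trace, finsetSum_coeff] at this
    simp only [adjugateCoeff, coeff_X_mul, Matrix.trace, diag_apply, matPolyEquiv_coeff_apply]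
    simp only [diag_apply] at this
    rw [← this]
    push_cast
    ring

/-- Beyond the degree there is nothing to show. The recursion carries the vanishing downwards as
long as χ has no coefficient at k. -/
theorem adjugateCoeff_of_card_lt (B : Matrix ι ι R) {k : ℕ} (hk : Fintype.card ι < k) :
    adjugateCoeff B k = 0 := by
  nontriviality R
  have key (m : ℕ) : ∀ k, Fintype.card ι < k →
      (X * matPolyEquiv (adjugate (charmatrix B))).natDegree < k + m → adjugateCoeff B k = 0 := by
    induction m with
    | zero => exact fun k _ h => coeff_eq_zero_of_natDegree_lt h
    | succ m ih =>
      intro k hk h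
      rw [adjugateCoeff_eq, ih (k + 1) (by omega) (by omega),
        coeff_eq_zero_of_natDegree_lt (by rwa [charpoly_natDegree_eq_dim])]
      simp
  exact key (X * matPolyEquiv (adjugate (charmatrix B))).natDegree.succ k hk (by omega)

theorem adjugateCoeff_card (B : Matrix ι ι R) : adjugateCoeff B (Fintype.card ι) = 1 := by
  nontriviality R
  have h := B.charpoly_monic.coeff_natDegree
  rw [charpoly_natDegree_eq_dim] at h
  rw [adjugateCoeff_eq, adjugateCoeff_of_card_lt B (Nat.lt_succ_self _), h]
  simp

/-- Together with the recursion at k = 0 this exhibits the inverse of B, up to a scalar, as the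
coefficient at 1. -/
theorem adjugateCoeff_zero (B : Matrix ι ι R) : adjugateCoeff B 0 = 0 := by
  simp [adjugateCoeff]

end FaddeevLeVerrier

/-! ### Correctness of the Faddeev–LeVerrier rounds -/

section Rounds

variable {K : Type} [Field K] [LinearOrder K] {n : ℕ}

theorem run_identityProg : (identityProg (ρ := K) (n := n)).run = (1 : Matrix (Fin n) (Fin n) K) := by
  funext i j
  by_cases h : i = j <;> simp [identityProg, Instr.eval, h, Matrix.one_apply]

theorem run_mulProg (A B : Fin n → Fin n → K) :
    (mulProg A B).run = fun i j => ∑ l, A i l * B l j := by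
  funext i j
  simp [mulProg, Instr.eval]

/-- The matrix `N` of round `m` of the Faddeev–LeVerrier method. -/
def leverrierMatrix (B : Matrix (Fin n) (Fin n) K) (m : ℕ) : Matrix (Fin n) (Fin n) K :=
  (leverrier B m).run.1

/-- The number `c` of round `m` of the Faddeev–LeVerrier method. -/
def leverrierScalar (B : Matrix (Fin n) (Fin n) K) (m : ℕ) : K :=
  (leverrier B m).run.2

theorem leverrierMatrix_zero (B : Matrix (Fin n) (Fin n) K) : leverrierMatrix B 0 = 1 := by
  simp [leverrierMatrix, leverrier, run_identityProg]

theorem leverrierScalar_zero (B : Matrix (Fin n) (Fin n) K) : leverrierScalar B 0 = 1 := by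
  simp [leverrierScalar, leverrier, Instr.eval]

theorem run_mulProg_leverrier (B : Matrix (Fin n) (Fin n) K) (m : ℕ) :
    (mulProg B (leverrier B m).run.1).run = fun i j => (B * leverrierMatrix B m) i j :=
  run_mulProg B _

theorem leverrierScalar_succ (B : Matrix (Fin n) (Fin n) K) (m : ℕ) :
    leverrierScalar B (m + 1) = (0 - (B * leverrierMatrix B m).trace) / (m + 1 : ℕ) := by
  simp [leverrierScalar, leverrier, run_mulProg_leverrier, Instr.eval, Matrix.trace]

theorem leverrierMatrix_succ (B : Matrix (Fin n) (Fin n) K) (m : ℕ) :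
    leverrierMatrix B (m + 1) =
      B * leverrierMatrix B m + Matrix.scalar (Fin n) (leverrierScalar B (m + 1)) := by
  rw [leverrierScalar_succ]
  ext i j
  by_cases h : i = j
  · subst h
    rw [leverrierMatrix]
    simp [leverrier, run_mulProg_leverrier, Instr.eval, Matrix.trace]
  · rw [leverrierMatrix]
    simp [leverrier, run_mulProg_leverrier, h]

/-- Put k = n - (m + 1). Traces in the recursion give tr(B N) + n c = k c, that is, (m + 1) c =
-tr(B N), the rule of the program. Characteristic zero allows the division. -/
theorem leverrier_eq [IsStrictOrderedRing K] (B : Matrix (Fin n) (Fin n) K) {m : ℕ} (hm : m ≤ n) :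
    leverrierMatrix B m = adjugateCoeff B (n - m) ∧
      leverrierScalar B m = B.charpoly.coeff (n - m) := by
  induction m with
  | zero =>
    have h := B.charpoly_monic.coeff_natDegree
    have h' := adjugateCoeff_card B
    rw [Matrix.charpoly_natDegree_eq_dim, Fintype.card_fin] at h
    rw [Fintype.card_fin] at h'
    simp [leverrierMatrix_zero, leverrierScalar_zero, h, h']
  | succ m ih =>
    have hk : n - m = n - (m + 1) + 1 := by omega
    have h1 := adjugateCoeff_eq B (n - (m + 1))
    have h2 := trace_adjugateCoeff B (n - (m + 1))
    rw [← hk] at h1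
    have hc : leverrierScalar B (m + 1) = B.charpoly.coeff (n - (m + 1)) := by
      rw [leverrierScalar_succ, (ih (by omega)).1]
      rw [h1, Matrix.trace_add, Nat.cast_sub hm] at h2
      have h3 : (Matrix.scalar (Fin n) (B.charpoly.coeff (n - (m + 1)))).trace =
          n * B.charpoly.coeff (n - (m + 1)) := by simp [Matrix.trace]
      rw [h3] at h2
      rw [div_eq_iff (by positivity)]
      linear_combination -h2
    exact ⟨by rw [leverrierMatrix_succ, hc, (ih (by omega)).1, h1], hc⟩

theorem run_detProg [IsStrictOrderedRing K] (B : Matrix (Fin n) (Fin n) K) :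
    (detProg (Matrix.of.symm B)).run = B.det := by
  change (detProg B).run = B.det
  rw [Matrix.det_eq_sign_charpoly_coeff, Fintype.card_fin]
  simp only [detProg, Prog.bind_eq, Prog.run_bind]
  have hs := (leverrier_eq B le_rfl).2
  rw [Nat.sub_self, leverrierScalar] at hs
  split_ifs with h
  · simp [hs, (Nat.even_iff.mpr h).neg_one_pow]
  · simp [hs, (Nat.not_even_iff_odd.mp (mt Nat.even_iff.mp h)).neg_one_pow, Instr.eval]

theorem run_invColProg [IsStrictOrderedRing K] (B : Matrix (Fin n) (Fin n) K) (hB : B.det ≠ 0)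
    (i : Fin n) : (invColProg (Matrix.of.symm B) i).run = fun j => B⁻¹ j i := by
  change (invColProg B i).run = _
  -- The index i forces n ≥ 1, so the truncated subtraction is harmless.
  have hn : n - (n - 1) = 1 := by have := i.pos; omega
  have h := adjugateCoeff_eq B 0
  rw [adjugateCoeff_zero] at h
  have hc : B.charpoly.coeff 0 ≠ 0 := by
    intro h0
    rw [Matrix.det_eq_sign_charpoly_coeff, h0] at hB
    simp at hB
  have hinv : B⁻¹ = (-B.charpoly.coeff 0)⁻¹ • adjugateCoeff B 1 := by
    refine Matrix.inv_eq_right_inv ?_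
    rw [Matrix.mul_smul, eq_neg_of_add_eq_zero_left h.symm]
    ext a b
    by_cases hab : a = b <;> simp [hab, hc, Matrix.one_apply]
  funext j
  have h1 := congrFun (congrFun (leverrier_eq B (Nat.sub_le n 1)).1 j) i
  have h2 := (leverrier_eq B le_rfl).2
  rw [hn, leverrierMatrix] at h1
  rw [Nat.sub_self, leverrierScalar] at h2
  simp [invColProg, h1, h2, Instr.eval, hinv, div_eq_inv_mul]

end Rounds

/-! ### Blocks padded to full size by the identity -/

section Padding

variable {K : Type} [Field K] {n : ℕ}

/-- The `n × n` matrix with the block `M_αα` on `α` and the identity on the complement. -/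
def padded (M : Matrix (Fin n) (Fin n) K) (α : Finset (Fin n)) : Matrix (Fin n) (Fin n) K :=
  Matrix.of fun i j => if i ∈ α ∧ j ∈ α then M i j else if i = j then 1 else 0

theorem run_padProg [LinearOrder K] (M : Fin n → Fin n → K) (α : Finset (Fin n)) :
    (padProg M α).run = Matrix.of.symm (padded (Matrix.of M) α) := by
  funext i j
  simp only [padProg, run_tabulate, padded, Matrix.of_apply, Matrix.of_symm_apply]
  split_ifs <;> simp [Instr.eval]

theorem det_padded (M : Matrix (Fin n) (Fin n) K) (α : Finset (Fin n)) :
    (padded M α).det = (principal M α).det := by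
  have h1 : padded M α =
      Matrix.of (α.piecewise (padded M α).row (1 : Matrix (Fin n) (Fin n) K).row) := by
    ext i j
    by_cases hi : i ∈ α <;> simp [hi, padded, Finset.piecewise, Matrix.row, Matrix.one_apply]
  have h2 : ((padded M α).submatrix (↑) (↑) : Matrix α α K) = principal M α := by
    ext i j
    simp [padded, principal]
  rw [h1, Matrix.det_piecewise_one_eq_submatrix_det, h2]

/-- Cofactor i replaces row i by a unit vector. A matrix with identity rows outside a set has the
minor on that set as determinant, whatever is left in column i. -/
theorem adjugate_padded (M : Matrix (Fin n) (Fin n) K) {α : Finset (Fin n)} (i : Fin n) :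
    (padded M α).adjugate i i = (principal M (α.erase i)).det := by
  have h1 : (padded M α).updateRow i (Pi.single i 1) =
      Matrix.of ((α.erase i).piecewise (padded M α).row (1 : Matrix (Fin n) (Fin n) K).row) := by
    ext k j
    by_cases hki : k = i
    · subst hki
      simp [Finset.piecewise, Matrix.row, Matrix.one_apply, Pi.single_apply, eq_comm]
    · by_cases hk : k ∈ α <;>
        simp [hki, hk, padded, Finset.piecewise, Matrix.row, Matrix.one_apply]
  have h2 : ((padded M α).submatrix (↑) (↑) : Matrix (α.erase i : Finset (Fin n)) _ K) =
      principal M (α.erase i) := by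
    ext k j
    simp [padded, principal, Finset.mem_of_mem_erase k.2, Finset.mem_of_mem_erase j.2]
  rw [Matrix.adjugate_apply, h1, Matrix.det_piecewise_one_eq_submatrix_det, h2]

theorem padded_mulVec (M : Matrix (Fin n) (Fin n) K) {α : Finset (Fin n)} {x : Fin n → K}
    (hx : ∀ j ∉ α, x j = 0) {i : Fin n} (hi : i ∈ α) :
    (padded M α).mulVec x i = M.mulVec x i := by
  rw [Matrix.mulVec, dotProduct, Matrix.mulVec, dotProduct]
  refine Finset.sum_congr rfl fun j _ => ?_
  by_cases hj : j ∈ α <;> simp [padded, hi, hj, hx]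

/-- The padded matrix maps the column of the small inverse, extended by zero, to the unit vector.
Inverting identifies the column. -/
theorem inv_padded (M : Matrix (Fin n) (Fin n) K) {α : Finset (Fin n)}
    (hdet : (principal M α).det ≠ 0) (i : α) (j : Fin n) :
    (padded M α)⁻¹ j i = if h : j ∈ α then (principal M α)⁻¹ ⟨j, h⟩ i else 0 := by
  set v : Fin n → K := fun j => if h : j ∈ α then (principal M α)⁻¹ ⟨j, h⟩ i else 0 with hv
  have hunit : IsUnit (padded M α).det := by rwa [det_padded, isUnit_iff_ne_zero]
  have key : (padded M α).mulVec v = Pi.single (i : Fin n) 1 := by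
    funext k
    by_cases hk : k ∈ α
    · have h1 := congrFun (congrFun (Matrix.mul_nonsing_inv (principal M α)
        (isUnit_iff_ne_zero.mpr hdet)) ⟨k, hk⟩) i
      rw [Matrix.mul_apply] at h1
      have h2 : (padded M α).mulVec v k = ∑ j ∈ α, M k j * v j := by
        rw [Matrix.mulVec, dotProduct, ← Finset.sum_subset (Finset.subset_univ α)]
        · exact Finset.sum_congr rfl fun j hj => by simp [padded, hk, hj]
        · intro j _ hj
          simp [hv, hj]
      rw [h2, ← Finset.sum_coe_sort α]
      have h3 : ∀ j : α, M k j * v j = principal M α ⟨k, hk⟩ j * (principal M α)⁻¹ j i :=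
        fun j => by simp [hv, principal]
      simp only [h3, h1, Matrix.one_apply, Pi.single_apply, Subtype.ext_iff]
    · have hne : k ≠ i := fun h => hk (h ▸ i.2)
      rw [Pi.single_eq_of_ne hne, Matrix.mulVec, dotProduct]
      refine Finset.sum_eq_zero fun j _ => ?_
      by_cases hj : j ∈ α
      · have : k ≠ j := fun h => hk (h ▸ hj)
        simp [padded, hk, this]
      · simp [hv, hj]
  have h4 : (padded M α)⁻¹.mulVec ((padded M α).mulVec v) = v := by
    rw [Matrix.mulVec_mulVec, Matrix.nonsing_inv_mul _ hunit, Matrix.one_mulVec]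
  rw [key, Matrix.mulVec_single_one] at h4
  exact congrFun h4 j

end Padding

/-! ### The minimum ratio and the reduction step -/

section Theta

variable {K : Type} [Field K] [LinearOrder K] {ι : Type} [Fintype ι] [DecidableEq ι]
  {A : Matrix ι ι K} {x : ι → K} {i : ι}

/-- In this form minima computed in different ways are identified by uniqueness of least elements.
-/
theorem isLeast_theta {k : ι} (hk : 0 < A⁻¹ k i) :
    IsLeast {r | ∃ j, 0 < A⁻¹ j i ∧ x j / A⁻¹ j i = r} (theta A x i) := by
  have h : (Finset.univ.filter fun j => 0 < A⁻¹ j i).Nonempty := ⟨k, by simpa using hk⟩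
  rw [theta, dif_pos h]
  constructor
  · obtain ⟨j, hj, he⟩ := Finset.exists_mem_eq_inf' h fun j => x j / A⁻¹ j i
    exact ⟨j, (Finset.mem_filter.mp hj).2, he.symm⟩
  · rintro r ⟨j, hj, rfl⟩
    exact Finset.inf'_le (fun j => x j / A⁻¹ j i) (by simpa using hj)

theorem theta_of_nonpos (h : ∀ j, A⁻¹ j i ≤ 0) : theta A x i = 0 :=
  dif_neg <| Finset.not_nonempty_iff_eq_empty.mpr <|
    Finset.filter_false_of_mem fun j _ => not_lt.mpr (h j)

theorem reduceStep_apply (j : ι) : reduceStep A x i j = x j - theta A x i * A⁻¹ j i := by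
  simp [reduceStep]

theorem mulVec_reduceStep (hA : IsUnit A.det) :
    A.mulVec (reduceStep A x i) = A.mulVec x - theta A x i • Pi.single i 1 := by
  rw [reduceStep, Matrix.mulVec_sub, Matrix.mulVec_smul, Matrix.mulVec_mulVec,
    Matrix.mul_nonsing_inv _ hA, Matrix.one_mulVec]

/-- The index attaining the minimum ratio is annihilated; this is what shrinks the support. -/
theorem exists_reduceStep_eq_zero {k : ι} (hk : 0 < A⁻¹ k i) :
    ∃ j, 0 < A⁻¹ j i ∧ reduceStep A x i j = 0 := by
  obtain ⟨j, hj, he⟩ := (isLeast_theta (x := x) hk).1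
  exact ⟨j, hj, by rw [reduceStep_apply, ← he, div_mul_cancel₀ _ hj.ne', sub_self]⟩

variable [IsStrictOrderedRing K]

theorem theta_nonneg (hx : ∀ j, 0 ≤ x j) : 0 ≤ theta A x i := by
  by_cases h : ∃ k, 0 < A⁻¹ k i
  · obtain ⟨k, hk⟩ := h
    obtain ⟨j, hj, he⟩ := (isLeast_theta (x := x) hk).1
    exact he ▸ div_nonneg (hx j) hj.le
  · exact (theta_of_nonpos (by simpa using h)).ge

/-- Where the column of the inverse is positive, θ is at most the ratio; elsewhere a nonpositive
number is subtracted. -/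
theorem reduceStep_nonneg (hx : ∀ j, 0 ≤ x j) (j : ι) : 0 ≤ reduceStep A x i j := by
  rw [reduceStep_apply, sub_nonneg]
  rcases lt_or_ge 0 (A⁻¹ j i) with hj | hj
  · exact (le_div_iff₀ hj).mp ((isLeast_theta hj).2 ⟨j, hj, rfl⟩)
  · exact (mul_nonpos_of_nonneg_of_nonpos (theta_nonneg hx) hj).trans (hx j)

end Theta

/-! ### The invariant of the recursion -/

section Reduction

variable {K : Type} [Field K] [LinearOrder K] {n : ℕ} {M : Matrix (Fin n) (Fin n) K}
  {α : Finset (Fin n)} {x : Fin n → K}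

theorem reduceOn_of_notMem {i j : Fin n} (hj : j ∉ α) : reduceOn M α x i j = 0 :=
  dif_neg fun h => hj h.2

/-- The padded column vanishes outside α, so padding contributes no new ratio. -/
theorem theta_padded [IsStrictOrderedRing K] (hdet : (principal M α).det ≠ 0) (i : α) :
    theta (padded M α) x i = theta (principal M α) (fun a => x a) i := by
  have hinv := inv_padded M hdet i
  by_cases h : ∃ k, 0 < (principal M α)⁻¹ k i
  · obtain ⟨k, hk⟩ := h
    have hk' : 0 < (padded M α)⁻¹ k i := by rw [hinv, dif_pos k.2]; exact hk
    refine (isLeast_theta hk').unique ?_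
    convert isLeast_theta (x := fun a : α => x a) hk using 1
    ext r
    constructor
    · rintro ⟨j, hj, rfl⟩
      rw [hinv] at hj ⊢
      split_ifs at hj ⊢ with hjα
      · exact ⟨⟨j, hjα⟩, hj, rfl⟩
      · exact absurd hj (lt_irrefl _)
    · rintro ⟨j, hj, rfl⟩
      refine ⟨j, ?_, ?_⟩ <;> rw [hinv, dif_pos j.2]
      exact hj
  · push Not at h
    rw [theta_of_nonpos h, theta_of_nonpos]
    intro j
    rw [hinv]
    split_ifs
    exacts [h _, le_rfl]

/-- Lets all later arguments use full-size matrices, as the program does. -/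
theorem reduceOn_eq_reduceStep [IsStrictOrderedRing K] (hdet : (principal M α).det ≠ 0)
    (hx : ∀ j ∉ α, x j = 0) {i : Fin n} (hi : i ∈ α) :
    reduceOn M α x i = reduceStep (padded M α) x i := by
  funext j
  have h1 := inv_padded M hdet ⟨i, hi⟩ j
  have h2 := theta_padded (x := x) hdet ⟨i, hi⟩
  rw [reduceStep_apply, h2, h1, reduceOn]
  by_cases hj : j ∈ α
  · rw [dif_pos ⟨hi, hj⟩, reduceStep_apply, dif_pos hj]
  · rw [dif_neg (fun h => hj h.2), dif_neg hj, hx j hj]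
    simp

/-- The hypotheses on the input of a recursive call. -/
structure Admissible (M : Matrix (Fin n) (Fin n) K) (α : Finset (Fin n)) (x : Fin n → K) :
    Prop where
  pos : ∀ i ∈ α, 0 < x i
  zero : ∀ i ∉ α, x i = 0
  nonpos : ∀ i ∈ α, M.mulVec x i ≤ 0

theorem Admissible.nonneg (h : Admissible M α x) (j : Fin n) : 0 ≤ x j := by
  by_cases hj : j ∈ α
  exacts [(h.pos j hj).le, (h.zero j hj).ge]

variable [IsStrictOrderedRing K]

theorem Admissible.reduceOn_nonneg (h : Admissible M α x) (hdet : (principal M α).det ≠ 0)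
    {i : Fin n} (hi : i ∈ α) (j : Fin n) : 0 ≤ reduceOn M α x i j := by
  rw [reduceOn_eq_reduceStep hdet h.zero hi]
  exact reduceStep_nonneg h.nonneg j

theorem Admissible.mulVec_reduceOn (h : Admissible M α x) (hdet : (principal M α).det ≠ 0)
    {i : Fin n} (hi : i ∈ α) {j : Fin n} (hj : j ∈ α) :
    M.mulVec (reduceOn M α x i) j ≤ 0 := by
  rw [← padded_mulVec M (fun k => reduceOn_of_notMem) hj, reduceOn_eq_reduceStep hdet h.zero hi,
    mulVec_reduceStep (by rwa [det_padded, isUnit_iff_ne_zero]), Pi.sub_apply,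
    padded_mulVec M h.zero hj, sub_nonpos]
  refine (h.nonpos j hj).trans ?_
  rw [Pi.smul_apply, smul_eq_mul]
  refine mul_nonneg (theta_nonneg h.nonneg) ?_
  rw [Pi.single_apply]
  split_ifs <;> simp

/-- Cramer's rule: the entry is the quotient of the two minors. -/
theorem inv_padded_pos (hdet : 0 < (principal M α).det) {i : Fin n}
    (hdeti : 0 < (principal M (α.erase i)).det) : 0 < (padded M α)⁻¹ i i := by
  rw [Matrix.inv_def, Matrix.smul_apply, adjugate_padded, det_padded, Ring.inverse_eq_inv',
    smul_eq_mul]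
  positivity

theorem Admissible.psupp_reduceOn_ssubset (h : Admissible M α x)
    (hdet : 0 < (principal M α).det) {i : Fin n} (hi : i ∈ α)
    (hdeti : 0 < (principal M (α.erase i)).det) : psupp (reduceOn M α x i) ⊂ α := by
  obtain ⟨j, hj, hj0⟩ := exists_reduceStep_eq_zero (x := x) (inv_padded_pos hdet hdeti)
  rw [← reduceOn_eq_reduceStep hdet.ne' h.zero hi] at hj0
  refine Finset.ssubset_iff_of_subset (fun k hk => ?_) |>.mpr ⟨j, ?_, by simp [psupp, hj0]⟩
  · by_contra hkα
    simp [psupp, reduceOn_of_notMem hkα] at hk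
  · by_contra hjα
    -- The annihilated index lies in α, since outside α the column of the inverse has no positive
    -- entry.
    have := inv_padded M hdet.ne' ⟨i, hi⟩ j
    rw [dif_neg hjα] at this
    exact hj.ne' this

/-- If all reductions vanished, A x would be θ_l e_l for every l in α. Two distinct indices force θ
= 0, and then the reduction is x itself, which is positive on α. -/
theorem Admissible.exists_reduceOn_ne_zero (h : Admissible M α x) (hcard : 2 ≤ α.card)
    (hdet : 0 < (principal M α).det) : ∃ i ∈ α, reduceOn M α x i ≠ 0 := by
  by_contra! hcon
  obtain ⟨i, hi, k, hk, hik⟩ := Finset.one_lt_card.mp hcard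
  have key (l : Fin n) (hl : l ∈ α) :
      (padded M α).mulVec x = theta (padded M α) x l • Pi.single l 1 := by
    have := mulVec_reduceStep (A := padded M α) (x := x) (i := l)
      (by rw [det_padded, isUnit_iff_ne_zero]; exact hdet.ne')
    rw [← reduceOn_eq_reduceStep hdet.ne' h.zero hl, hcon l hl, Matrix.mulVec_zero] at this
    exact sub_eq_zero.mp this.symm
  have hθ : theta (padded M α) x i = 0 := by
    simpa [hik] using congrFun ((key i hi).symm.trans (key k hk)) i
  have hy := congrFun (hcon i hi) i
  rw [reduceOn_eq_reduceStep hdet.ne' h.zero hi, reduceStep_apply, hθ] at hy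
  simp [(h.pos i hi).ne'] at hy

/-- Row inequalities survive because the new support lies in α, and M y needs no other entries of y.
-/
theorem Admissible.reduceOn (h : Admissible M α x) (hdet : 0 < (principal M α).det) {i : Fin n}
    (hi : i ∈ α) (hdeti : 0 < (principal M (α.erase i)).det) :
    Admissible M (psupp (reduceOn M α x i)) (reduceOn M α x i) where
  pos j hj := (Finset.mem_filter.mp hj).2
  zero j hj := le_antisymm (by simpa [psupp] using hj) (h.reduceOn_nonneg hdet.ne' hi j)
  nonpos j hj := h.mulVec_reduceOn hdet.ne' hi ((h.psupp_reduceOn_ssubset hdet hi hdeti).1 hj)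

theorem Admissible.psupp_reduceOn_nonempty (h : Admissible M α x)
    (hdet : (principal M α).det ≠ 0) {i : Fin n} (hi : i ∈ α) (hne : NonposMinor.reduceOn M α x i ≠ 0) :
    (psupp (NonposMinor.reduceOn M α x i)).Nonempty := by
  obtain ⟨j, hj⟩ := Function.ne_iff.mp hne
  exact ⟨j, Finset.mem_filter.mpr
    ⟨Finset.mem_univ _, (h.reduceOn_nonneg hdet hi j).lt_of_ne' hj⟩⟩

theorem Admissible.det_nonpos_of_card_eq_one (h : Admissible M α x) (hcard : α.card = 1) :
    (principal M α).det ≤ 0 := by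
  obtain ⟨a, rfl⟩ := Finset.card_eq_one.mp hcard
  have h1 := h.nonpos a (Finset.mem_singleton_self a)
  have h2 : M.mulVec x a = M a a * x a := by
    rw [Matrix.mulVec, dotProduct]
    exact Finset.sum_eq_single a (fun j _ hj => by simp [h.zero j (by simpa using hj)]) (by simp)
  rw [h2] at h1
  rw [Matrix.det_eq_elem_of_card_eq_one (by simp) ⟨a, Finset.mem_singleton_self a⟩]
  exact nonpos_of_mul_nonpos_left h1 (h.pos a (Finset.mem_singleton_self a))

end Reduction

/-! ### The two searches as separate programs -/

section Parts

variable {ρ : Type} {n : ℕ}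

/-- The search for a nonpositive minor of size one less. -/
def minorSearchProg (M : Fin n → Fin n → ρ) (α : Finset (Fin n)) :
    Prog ρ (Option (Finset (Fin n))) :=
  firstSome n fun i =>
    if i ∈ α then do
      scanProg n
      let c ← minorNonposProg M (α.erase i)
      if c then pure (some (α.erase i)) else pure none
    else pure none

/-- The search for a nonzero reduction. -/
def reductionSearchProg (M : Fin n → Fin n → ρ) (α : Finset (Fin n)) (x : Fin n → ρ) :
    Prog ρ (Option (Fin n → ρ)) :=
  firstSome n fun i =>
    if i ∈ α then do
      let y ← reduceProg M α x i
      let c ← nonzeroProg y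
      if c then pure (some y) else pure none
    else pure none

theorem recursiveFindProg_succ (M : Fin n → Fin n → ρ) (t : ℕ) (α : Finset (Fin n))
    (x : Fin n → ρ) :
    recursiveFindProg M (t + 1) α x = (scanProg n).bind fun _ =>
      if α.card = 1 then ret α else (minorNonposProg M α).bind fun b =>
        if b then ret α else (minorSearchProg M α).bind fun r =>
          match r with
          | some γ => ret γ
          | none => (reductionSearchProg M α x).bind fun s =>
            match s with
            | some y => (psuppProg y).bind fun γ => recursiveFindProg M t γ y
            | none => ret ∅ :=
  rfl

end Parts

theorem findSome?_ite_eq_map_find? {ι β : Type} (l : List ι) (p : ι → Prop) [DecidablePred p]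
    (g : ι → β) :
    (l.findSome? fun i => if p i then some (g i) else none) =
      (l.find? fun i => decide (p i)).map g := by
  induction l with
  | nil => rfl
  | cons a l ih => by_cases h : p a <;> simp [h, ih]

/-! ### Values returned by the routines -/

section Run

variable {K : Type} [Field K] [LinearOrder K] {n : ℕ}

/-- The minimum is described as a least element, so ties play no role and it can be matched with
`theta`. -/
theorem run_minRatioProg_spec (k : ℕ) (x b : Fin k → K) :
    ((minRatioProg k x b).run = none → ∀ j, b j ≤ 0) ∧
      ∀ s, (minRatioProg k x b).run = some s → IsLeast {r | ∃ j, 0 < b j ∧ x j / b j = r} s := by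
  induction k with
  | zero => simp [minRatioProg]
  | succ k ih =>
    obtain ⟨ih1, ih2⟩ := ih (fun j => x j.succ) (fun j => b j.succ)
    simp only [minRatioProg, bind_eq, pure_eq, run_bind, run_instr, Instr.eval, Nat.cast_zero,
      decide_eq_true_eq]
    by_cases h0 : b 0 ≤ 0
    · simp only [h0, if_true, run_ret]
      refine ⟨fun h => Fin.cases h0 (ih1 h), fun s hs => ⟨?_, ?_⟩⟩
      · obtain ⟨j, hj⟩ := (ih2 s hs).1
        exact ⟨j.succ, hj⟩
      · rintro r ⟨j, hj, rfl⟩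
        induction j using Fin.cases with
        | zero => exact absurd hj h0.not_gt
        | succ j => exact (ih2 s hs).2 ⟨j, hj, rfl⟩
    · simp only [h0, if_false]
      cases hm : (minRatioProg k (fun j => x j.succ) fun j => b j.succ).run with
      | none =>
        simp only [run_bind, run_instr, Instr.eval, run_ret, reduceCtorEq, false_imp_iff,
          Option.some.injEq, true_and]
        rintro s rfl
        refine ⟨⟨0, not_le.mp h0, rfl⟩, ?_⟩
        rintro r ⟨j, hj, rfl⟩
        induction j using Fin.cases with
        | zero => rfl
        | succ j => exact absurd hj (ih1 hm j).not_gt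
      | some s =>
        obtain ⟨⟨i, hi, hs⟩, hmin⟩ := ih2 s hm
        simp only [run_bind, run_instr, Instr.eval, decide_eq_true_eq]
        by_cases hle : x 0 / b 0 ≤ s
        · simp only [hle, if_true, run_ret, reduceCtorEq, false_imp_iff, Option.some.injEq,
            true_and]
          rintro _ rfl
          refine ⟨⟨0, not_le.mp h0, rfl⟩, ?_⟩
          rintro r ⟨j, hj, rfl⟩
          induction j using Fin.cases with
          | zero => rfl
          | succ j => exact hle.trans (hmin ⟨j, hj, rfl⟩)
        · simp only [hle, if_false, run_ret, reduceCtorEq, false_imp_iff, Option.some.injEq,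
            true_and]
          rintro _ rfl
          refine ⟨⟨i.succ, hi, hs⟩, ?_⟩
          rintro r ⟨j, hj, rfl⟩
          induction j using Fin.cases with
          | zero => exact (not_le.mp hle).le
          | succ j => exact hmin ⟨j, hj, rfl⟩

/-- The vector computed by the reduction step, in terms of the column `b` and the step size. -/
theorem run_reduceProg_eq (M : Fin n → Fin n → K) (α : Finset (Fin n)) (x : Fin n → K)
    (i : Fin n) :
    (reduceProg M α x i).run = fun j =>
      x j - (minRatioProg n x (invColProg (padProg M α).run i).run).run.getD 0 *
        (invColProg (padProg M α).run i).run j := by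
  simp only [reduceProg, bind_eq, pure_eq, run_bind]
  cases (minRatioProg n x (invColProg (padProg M α).run i).run).run <;> simp [Instr.eval]

theorem run_nonzeroProg (y : Fin n → K) : (nonzeroProg y).run = decide (y ≠ 0) := by
  simp only [nonzeroProg, bind_eq, pure_eq, run_bind, run_ret, run_firstSome, run_instr,
    Instr.eval, Nat.cast_zero, Bool.and_eq_true, decide_eq_true_eq]
  rw [eq_comm, Bool.eq_iff_iff, decide_eq_true_iff, Function.ne_iff, List.findSome?_isSome_iff]
  simp only [List.mem_finRange, true_and, Pi.zero_apply]
  refine exists_congr fun j => ?_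
  split_ifs with h
  · simp [le_antisymm h.1 h.2]
  · have : y j ≠ 0 := fun h0 => h (by simp [h0])
    simp [this]

theorem run_psuppProg (y : Fin n → K) : (psuppProg y).run = psupp y := by
  simp [psuppProg, psupp, Instr.eval]

variable [IsStrictOrderedRing K]

theorem run_minorNonposProg (M : Fin n → Fin n → K) (α : Finset (Fin n)) :
    (minorNonposProg M α).run = decide ((principal (Matrix.of M) α).det ≤ 0) := by
  have h := run_detProg (padded (Matrix.of M) α)
  simp only [minorNonposProg, bind_eq, run_bind, run_instr, Instr.eval, Nat.cast_zero]
  rw [run_padProg, h, det_padded]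

theorem run_minorSearchProg (M : Fin n → Fin n → K) (α : Finset (Fin n)) :
    (minorSearchProg M α).run = ((List.finRange n).find? fun i =>
      decide (i ∈ α ∧ (principal (Matrix.of M) (α.erase i)).det ≤ 0)).map α.erase := by
  rw [minorSearchProg, run_firstSome, ← findSome?_ite_eq_map_find?]
  congr 1
  funext i
  by_cases hi : i ∈ α
  · by_cases hd : (principal (Matrix.of M) (α.erase i)).det ≤ 0 <;> simp [hi, hd, run_minorNonposProg]
  · simp [hi]

variable {M : Fin n → Fin n → K} {α : Finset (Fin n)} {x : Fin n → K}

theorem run_reduceProg (hdet : (principal (Matrix.of M) α).det ≠ 0) (hx : ∀ j ∉ α, x j = 0) {i : Fin n}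
    (hi : i ∈ α) : (reduceProg M α x i).run = reduceOn (Matrix.of M) α x i := by
  have hcol := run_invColProg (padded (Matrix.of M) α) (by rwa [det_padded]) i
  obtain ⟨h1, h2⟩ := run_minRatioProg_spec n x fun j => (padded (Matrix.of M) α)⁻¹ j i
  rw [run_reduceProg_eq, run_padProg, hcol, reduceOn_eq_reduceStep hdet hx hi]
  funext j
  rw [reduceStep_apply]
  cases hm : (minRatioProg n x fun j => (padded (Matrix.of M) α)⁻¹ j i).run with
  | none => rw [theta_of_nonpos (h1 hm), Option.getD_none]
  | some s =>
    obtain ⟨k, hk, -⟩ := (h2 s hm).1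
    rw [(h2 s hm).unique (isLeast_theta hk), Option.getD_some]

theorem run_reductionSearchProg (hdet : (principal (Matrix.of M) α).det ≠ 0) (hx : ∀ j ∉ α, x j = 0) :
    (reductionSearchProg M α x).run = ((List.finRange n).find? fun i =>
      decide (i ∈ α ∧ reduceOn (Matrix.of M) α x i ≠ 0)).map (reduceOn (Matrix.of M) α x) := by
  rw [reductionSearchProg, run_firstSome, ← findSome?_ite_eq_map_find?]
  congr 1
  funext i
  by_cases hi : i ∈ α
  · by_cases hd : reduceOn (Matrix.of M) α x i = 0 <;>
      simp [hi, hd, run_reduceProg hdet hx hi, run_nonzeroProg]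
  · simp [hi]

end Run

/-! ### Counting determinants -/

section Determinants

variable {K : Type} [Field K] [LinearOrder K] {n : ℕ}

theorem dets_padProg (M : Fin n → Fin n → K) (α : Finset (Fin n)) : (padProg M α).dets = 0 := by
  simp only [dets, padProg, cost_tabulate]
  refine Finset.sum_eq_zero fun i _ => ?_
  simp only [Instr.detWeight, zero_add]
  refine Finset.sum_eq_zero fun j _ => ?_
  split_ifs <;> simp [Instr.detWeight]

theorem dets_leverrier (B : Fin n → Fin n → K) (m : ℕ) : (leverrier B m).dets = 0 := by
  induction m with
  | zero =>
    simp only [dets, leverrier, identityProg, bind_eq, pure_eq, cost_bind, cost_tabulate,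
      cost_instr, cost_ret, Instr.detWeight, zero_add, add_zero]
    refine Finset.sum_eq_zero fun i _ => Finset.sum_eq_zero fun j _ => ?_
    split_ifs <;> simp [Instr.detWeight]
  | succ m ih =>
    rw [dets] at ih
    simp only [dets, leverrier, mulProg, bind_eq, pure_eq, cost_bind, cost_tabulate, ih,
      dets_sumProg, cost_instr, cost_ret, Instr.detWeight, zero_add, add_zero,
      Finset.sum_const_zero]
    refine Finset.sum_eq_zero fun i _ => Finset.sum_eq_zero fun j _ => ?_
    split_ifs <;> simp [Instr.detWeight]

theorem dets_detProg (B : Fin n → Fin n → K) : (detProg B).dets = 1 := by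
  have h := dets_leverrier B n
  rw [dets] at h
  simp only [dets, detProg, bind_eq, pure_eq, cost_bind, cost_instr, h]
  split_ifs <;> simp [Instr.detWeight]

theorem dets_invColProg (B : Fin n → Fin n → K) (i : Fin n) : (invColProg B i).dets = 0 := by
  have h := dets_leverrier B
  simp only [dets] at h
  simp [dets, invColProg, h, Instr.detWeight]

theorem dets_minRatioProg (k : ℕ) (x b : Fin k → K) : (minRatioProg k x b).dets = 0 := by
  induction k with
  | zero => simp [dets, minRatioProg]
  | succ k ih =>
    simp only [dets] at ih
    simp only [dets, minRatioProg, bind_eq, pure_eq, cost_bind, cost_instr, ih, Instr.detWeight]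
    split_ifs
    · simp
    · simp only [cost_bind, cost_instr, Instr.detWeight]
      cases (minRatioProg k (fun j => x j.succ) fun j => b j.succ).run
      · simp
      · simp only [cost_bind, cost_instr, Instr.detWeight]
        split_ifs <;> simp

theorem dets_reduceProg (M : Fin n → Fin n → K) (α : Finset (Fin n)) (x : Fin n → K)
    (i : Fin n) : (reduceProg M α x i).dets = 0 := by
  have h1 := dets_padProg M α
  have h2 := dets_invColProg (padProg M α).run i
  have h3 := dets_minRatioProg n x (invColProg (padProg M α).run i).run
  simp only [dets] at h1 h2 h3
  simp only [dets, reduceProg, bind_eq, pure_eq, cost_bind, h1, h2, h3]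
  cases (minRatioProg n x (invColProg (padProg M α).run i).run).run <;> simp [Instr.detWeight]

theorem dets_nonzeroProg (y : Fin n → K) : (nonzeroProg y).dets = 0 := by
  simp only [dets, nonzeroProg, bind_eq, pure_eq, cost_bind, cost_ret, add_zero]
  refine Nat.le_zero.mp ((cost_firstSome_le _ _ _).trans (Finset.sum_eq_zero fun i _ => ?_).le)
  simp only [cost_bind, cost_instr, Instr.detWeight]
  split_ifs <;> simp

theorem dets_psuppProg (y : Fin n → K) : (psuppProg y).dets = 0 := by
  simp [dets, psuppProg, Instr.detWeight]

theorem dets_scanProg : (scanProg n : Prog K Unit).dets = 0 := by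
  simp [dets, scanProg, Instr.detWeight]

theorem dets_minorNonposProg (M : Fin n → Fin n → K) (α : Finset (Fin n)) :
    (minorNonposProg M α).dets = 1 := by
  have h1 := dets_padProg M α
  have h2 := dets_detProg (padProg M α).run
  simp only [dets] at h1 h2
  simp [dets, minorNonposProg, h1, h2, Instr.detWeight]

theorem dets_minorSearchProg_le (M : Fin n → Fin n → K) (α : Finset (Fin n)) :
    (minorSearchProg M α).dets ≤ α.card := by
  refine (cost_firstSome_le _ _ _).trans ?_
  have (i : Fin n) : (Instr.detWeight Unit (.tick : Instr K Unit) + ((if i ∈ α then do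
      scanProg n
      let c ← minorNonposProg M (α.erase i)
      if c then pure (some (α.erase i)) else pure none
    else pure none : Prog K (Option (Finset (Fin n)))).cost Instr.detWeight)) =
      if i ∈ α then 1 else 0 := by
    have h1 := dets_scanProg (K := K) (n := n)
    have h2 := dets_minorNonposProg M (α.erase i)
    simp only [dets] at h1 h2
    by_cases hi : i ∈ α
    · simp only [hi, if_true, bind_eq, pure_eq, cost_bind, h1, h2, Instr.detWeight]
      split_ifs <;> simp
    · simp [hi, Instr.detWeight]
  simp only [this]
  simp

theorem dets_reductionSearchProg (M : Fin n → Fin n → K) (α : Finset (Fin n)) (x : Fin n → K) :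
    (reductionSearchProg M α x).dets = 0 := by
  refine Nat.le_zero.mp ((cost_firstSome_le _ _ _).trans (Finset.sum_eq_zero fun i _ => ?_).le)
  have h1 := dets_reduceProg M α x i
  have h2 := dets_nonzeroProg (reduceProg M α x i).run
  simp only [dets] at h1 h2
  by_cases hi : i ∈ α
  · simp only [hi, if_true, bind_eq, pure_eq, cost_bind, h1, h2, Instr.detWeight]
    split_ifs <;> simp
  · simp [hi, Instr.detWeight]

end Determinants

/-! ### Correctness of the recursion -/

section Correctness

variable {K : Type} [Field K] [LinearOrder K] [IsStrictOrderedRing K] {n : ℕ}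
  {M : Fin n → Fin n → K}

/-- Since |α| ≤ t and the support shrinks strictly, the depth bound is never exhausted. Nonemptiness
of α must be carried along, as the empty minor is 1. -/
theorem recursiveFind_spec (t : ℕ) {α : Finset (Fin n)} {x : Fin n → K}
    (h : Admissible (Matrix.of M) α x) (hne : α.Nonempty) (ht : α.card ≤ t) :
    ∃ β, (principal (Matrix.of M) β).det ≤ 0 ∧ recursiveFind (Matrix.of M) t α x = β ∧
      (recursiveFindProg M t α x).run = β ∧
      2 * (recursiveFindProg M t α x).dets ≤ α.card * (α.card + 3) := by
  induction t generalizing α x with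
  | zero => exact absurd hne.card_pos (by omega)
  | succ t ih =>
    have hs := dets_scanProg (K := K) (n := n)
    have hm := dets_minorNonposProg M α
    have hms := dets_minorSearchProg_le M α
    have hrs := dets_reductionSearchProg M α x
    simp only [dets] at hs hm hms hrs ih ⊢
    rw [recursiveFindProg_succ, recursiveFind]
    simp only [run_bind, cost_bind, hs, zero_add]
    by_cases hcard : α.card = 1
    · exact ⟨α, h.det_nonpos_of_card_eq_one hcard, by simp [hcard]⟩
    simp only [hcard, if_false, false_or, run_bind, cost_bind, hm, run_minorNonposProg,
      decide_eq_true_eq]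
    have hpos := hne.card_pos
    by_cases hdet : (principal (Matrix.of M) α).det ≤ 0
    · refine ⟨α, hdet, ?_⟩
      simp only [hdet, if_true, run_ret, cost_ret, true_and]
      nlinarith
    simp only [hdet, if_false, run_bind, cost_bind, run_minorSearchProg]
    rw [not_le] at hdet
    cases hfind : (List.finRange n).find?
        fun i => decide (i ∈ α ∧ (principal (Matrix.of M) (α.erase i)).det ≤ 0) with
    | some i =>
      have hi := List.find?_some hfind
      simp only [decide_eq_true_eq] at hi
      refine ⟨α.erase i, hi.2, ?_⟩
      simp only [Option.map_some, run_ret, cost_ret, true_and]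
      nlinarith
    | none =>
      have hminors (i : Fin n) (hi : i ∈ α) : 0 < (principal (Matrix.of M) (α.erase i)).det := by
        have := List.find?_eq_none.mp hfind i (List.mem_finRange i)
        simpa [hi] using this
      simp only [Option.map_none, run_bind, cost_bind, hrs, zero_add,
        run_reductionSearchProg hdet.ne' h.zero]
      cases hfind' : (List.finRange n).find?
          fun i => decide (i ∈ α ∧ reduceOn (Matrix.of M) α x i ≠ 0) with
      | none =>
        -- Failure is impossible here: α is nonempty and not a singleton, so it has two elements.
        obtain ⟨i, hi, hy⟩ := h.exists_reduceOn_ne_zero (by omega) hdet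
        have := List.find?_eq_none.mp hfind' i (List.mem_finRange i)
        simp [hi, hy] at this
      | some i =>
        have hi := List.find?_some hfind'
        simp only [decide_eq_true_eq] at hi
        have hps := dets_psuppProg (reduceOn (Matrix.of M) α x i)
        rw [dets] at hps
        simp only [Option.map_some, run_bind, cost_bind, run_psuppProg, hps, zero_add]
        have hlt := Finset.card_lt_card
          (h.psupp_reduceOn_ssubset hdet hi.1 (hminors i hi.1))
        obtain ⟨β, h1, h2, h3, h4⟩ := ih (h.reduceOn hdet hi.1 (hminors i hi.1))
          (h.psupp_reduceOn_nonempty hdet.ne' hi.1 hi.2) (by omega)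
        refine ⟨β, h1, h2, h3, ?_⟩
        -- With a = |α| and b ≤ a - 1 for the new support, 2(1 + a) + b(b + 3) ≤ a(a + 3), with
        -- equality for b = a - 1.
        nlinarith

end Correctness

/-! ### Counting steps -/

section Steps

variable {K : Type} [Field K] [LinearOrder K] {β γ : Type}

theorem steps_bind (P : Prog K β) (f : β → Prog K γ) :
    (P.bind f).steps = P.steps + (f P.run).steps := cost_bind _ _ _

theorem steps_instr (i : Instr K β) : (instr i).steps = 1 := rfl

theorem steps_ret (a : β) : (ret a : Prog K β).steps = 0 := rfl

theorem steps_tabulate_le {k c : ℕ} {f : Fin k → Prog K β} (h : ∀ i, (f i).steps ≤ c) :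
    (tabulate k f).steps ≤ k * (1 + c) := by
  rw [steps, cost_tabulate]
  refine (Finset.sum_le_card_nsmul _ _ (1 + c) fun i _ => ?_).trans (by simp)
  exact Nat.add_le_add_left (h i) 1

theorem steps_sumProg_le {k c : ℕ} {f : Fin k → Prog K K} (h : ∀ i, (f i).steps ≤ c) :
    (sumProg k f).steps ≤ 1 + k * (2 + c) := by
  rw [steps, cost_sumProg_one]
  refine Nat.add_le_add_left
    ((Finset.sum_le_card_nsmul _ _ (2 + c) fun i _ => ?_).trans (by simp)) 1
  exact Nat.add_le_add_left (h i) 2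

theorem steps_firstSome_le {k c : ℕ} {f : Fin k → Prog K (Option β)}
    (h : ∀ i, (f i).steps ≤ c) : (firstSome k f).steps ≤ k * (1 + c) := by
  refine (cost_firstSome_le _ _ _).trans
    ((Finset.sum_le_card_nsmul _ _ (1 + c) fun i _ => ?_).trans (by simp))
  exact Nat.add_le_add_left (h i) 1

section Bounds

variable {R : Type} [Semiring R]

/-- A bound for the number of steps to write an `n × n` table, one step for each entry. -/
def tableSteps (n : R) : R := n * (1 + n * 2)

/-- A bound for the number of steps of `mulProg`. -/
def mulSteps (n : R) : R := n * (1 + n * (1 + (1 + n * 3)))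

/-- A bound for the number of steps of one round of the Faddeev–LeVerrier method. -/
def roundSteps (n : R) : R := mulSteps n + (1 + n * 2) + 4 + tableSteps n

/-- A bound for the number of steps of `leverrier`. -/
def leverrierSteps (n : R) : R := tableSteps n + 1 + n * roundSteps n

/-- A bound for the number of steps of `minorNonposProg`. -/
def minorSteps (n : R) : R := tableSteps n + (leverrierSteps n + 3) + 2

/-- A bound for the number of steps of `reduceProg`. -/
def reduceSteps (n : R) : R :=
  tableSteps n + (leverrierSteps n + leverrierSteps n + 2 + n * 2) + n * 5 + 1 + n * 3

/-- A bound for the number of steps of one call of the recursive procedure. -/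
def callSteps (n : R) : R :=
  n + minorSteps n + n * (1 + (n + minorSteps n)) + n * (1 + (reduceSteps n + n * 4)) + n * 3

/-- A bound for the number of steps of the whole procedure. -/
def totalSteps (n : R) : R := n * callSteps n

end Bounds

/-- The bounds are written over any semiring so that one expression serves both as a number and, at
X, as the required polynomial. -/
theorem eval_totalSteps (n : ℕ) :
    (totalSteps (Polynomial.X : Polynomial ℕ)).eval n = totalSteps n := by
  simp [totalSteps, callSteps, reduceSteps, minorSteps, leverrierSteps, roundSteps, mulSteps,
    tableSteps]

theorem totalSteps_mono {m n : ℕ} (h : m ≤ n) : totalSteps m ≤ totalSteps n := by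
  simp only [totalSteps, callSteps, reduceSteps, minorSteps, leverrierSteps, roundSteps, mulSteps,
    tableSteps]
  gcongr

variable {n : ℕ}

theorem steps_padProg_le (M : Fin n → Fin n → K) (α : Finset (Fin n)) :
    (padProg M α).steps ≤ tableSteps n := by
  refine steps_tabulate_le fun i => steps_tabulate_le (c := 1) fun j => ?_
  split_ifs <;> simp [steps_ret, steps_instr]

theorem steps_identityProg_le : (identityProg (ρ := K) (n := n)).steps ≤ tableSteps n := by
  refine steps_tabulate_le fun i => steps_tabulate_le (c := 1) fun j => ?_
  split_ifs <;> simp [steps_instr]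

theorem steps_mulProg_le (A B : Fin n → Fin n → K) : (mulProg A B).steps ≤ mulSteps n :=
  steps_tabulate_le fun _ => steps_tabulate_le fun _ => steps_sumProg_le fun _ =>
    (steps_instr _).le

theorem steps_leverrier_le (B : Fin n → Fin n → K) (m : ℕ) :
    (leverrier B m).steps ≤ tableSteps n + 1 + m * roundSteps n := by
  induction m with
  | zero =>
    have := steps_identityProg_le (K := K) (n := n)
    simp only [leverrier, bind_eq, pure_eq, steps_bind, steps_instr, steps_ret]
    omega
  | succ m ih =>
    have h1 := steps_mulProg_le B (leverrier B m).run.1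
    have h2 := steps_sumProg_le (c := 0) (f := fun i : Fin n =>
      (ret ((mulProg B (leverrier B m).run.1).run i i) : Prog K K)) fun i => (steps_ret _).le
    simp only [leverrier, bind_eq, pure_eq, steps_bind, steps_instr, steps_ret]
    -- The four ones are the two constants, the subtraction and the division between the trace and
    -- the final table.
    refine le_trans (add_le_add ih (add_le_add h1 (add_le_add h2 (Nat.add_le_add_left
      (Nat.add_le_add_left (Nat.add_le_add_left (Nat.add_le_add_left (Nat.add_le_add_right
        (steps_tabulate_le fun i => steps_tabulate_le (c := 1) fun j => ?_) 0) 1) 1) 1) 1)))) ?_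
    · split_ifs <;> simp [steps_ret, steps_instr]
    · simp only [roundSteps, tableSteps]
      apply le_of_eq
      push_cast
      ring

theorem steps_leverrier_le_of_le (B : Fin n → Fin n → K) {m : ℕ} (hm : m ≤ n) :
    (leverrier B m).steps ≤ leverrierSteps n :=
  (steps_leverrier_le B m).trans (Nat.add_le_add_left (Nat.mul_le_mul_right _ hm) _)

theorem steps_detProg_le (B : Fin n → Fin n → K) : (detProg B).steps ≤ leverrierSteps n + 3 := by
  have h := steps_leverrier_le_of_le B le_rfl
  simp only [detProg, bind_eq, pure_eq, steps_bind, steps_instr]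
  split_ifs <;> simp only [steps_ret, steps_bind, steps_instr] <;> omega

theorem steps_invColProg_le (B : Fin n → Fin n → K) (i : Fin n) :
    (invColProg B i).steps ≤ leverrierSteps n + leverrierSteps n + 2 + n * 2 := by
  have h1 := steps_leverrier_le_of_le B (Nat.sub_le n 1)
  have h2 := steps_leverrier_le_of_le B le_rfl
  have h3 := steps_tabulate_le (c := 1) (f := fun j : Fin n =>
    instr (.arith .div ((leverrier B (n - 1)).run.1 j i)
      ((0 : ℕ) - (leverrier B n).run.2))) fun j => (steps_instr _).le
  simp only [invColProg, bind_eq, steps_bind, steps_instr, run_instr, Instr.eval]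
  omega

theorem steps_minRatioProg_le (k : ℕ) (x b : Fin k → K) : (minRatioProg k x b).steps ≤ k * 5 := by
  induction k with
  | zero => simp [minRatioProg, steps_ret]
  | succ k ih =>
    have := ih (fun j => x j.succ) fun j => b j.succ
    simp only [minRatioProg, bind_eq, pure_eq, steps_bind, steps_instr]
    split_ifs
    · simp only [steps_ret]
      omega
    · simp only [steps_bind, steps_instr]
      cases (minRatioProg k (fun j => x j.succ) fun j => b j.succ).run
      · simp only [steps_ret]
        omega
      · simp only [steps_bind, steps_instr]
        split_ifs <;> simp only [steps_ret] <;> omega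

theorem steps_reduceProg_le (M : Fin n → Fin n → K) (α : Finset (Fin n)) (x : Fin n → K)
    (i : Fin n) : (reduceProg M α x i).steps ≤ reduceSteps n := by
  have h1 := steps_padProg_le M α
  have h2 := steps_invColProg_le (padProg M α).run i
  have h3 := steps_minRatioProg_le n x (invColProg (padProg M α).run i).run
  have h4 (θ : K) : (tabulate n fun j => (instr (.arith .mul θ
      ((invColProg (padProg M α).run i).run j))).bind fun p =>
        instr (.arith .sub (x j) p)).steps ≤ n * (1 + 2) :=
    steps_tabulate_le fun j => le_rfl
  simp only [reduceProg, bind_eq, pure_eq, steps_bind, reduceSteps]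
  cases (minRatioProg n x (invColProg (padProg M α).run i).run).run with
  | none =>
    have := h4 (instr (.lit 0)).run
    simp only [steps_bind, steps_instr]
    omega
  | some s =>
    have := h4 s
    simp only [steps_bind, steps_ret, run_ret]
    omega

theorem steps_nonzeroProg_le (y : Fin n → K) : (nonzeroProg y).steps ≤ n * 4 := by
  simp only [nonzeroProg, bind_eq, pure_eq, steps_bind, steps_ret, add_zero]
  refine steps_firstSome_le (K := K) (c := 3) fun j => ?_
  simp only [steps_bind, steps_instr]
  split_ifs <;> simp [steps_ret]

theorem steps_psuppProg_le (y : Fin n → K) : (psuppProg y).steps ≤ n * 3 := by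
  simp only [psuppProg, bind_eq, pure_eq, steps_bind, steps_ret, add_zero]
  exact steps_tabulate_le (K := K) (c := 2) fun j => le_rfl

theorem steps_scanProg_le : (scanProg n : Prog K Unit).steps ≤ n := by
  simp only [scanProg, bind_eq, pure_eq, steps_bind, steps_ret, add_zero]
  exact (steps_tabulate_le fun j => (steps_ret _).le).trans (by simp)

theorem steps_minorNonposProg_le (M : Fin n → Fin n → K) (α : Finset (Fin n)) :
    (minorNonposProg M α).steps ≤ minorSteps n := by
  have h1 := steps_padProg_le M α
  have h2 := steps_detProg_le (padProg M α).run
  simp only [minorNonposProg, bind_eq, steps_bind, steps_instr, minorSteps]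
  omega

theorem steps_minorSearchProg_le (M : Fin n → Fin n → K) (α : Finset (Fin n)) :
    (minorSearchProg M α).steps ≤ n * (1 + (n + minorSteps n)) := by
  refine steps_firstSome_le fun i => ?_
  have h1 := steps_scanProg_le (K := K) (n := n)
  have h2 := steps_minorNonposProg_le M (α.erase i)
  split_ifs
  · simp only [bind_eq, pure_eq, steps_bind]
    split_ifs <;> simp only [steps_ret] <;> omega
  · simp [steps_ret]

theorem steps_reductionSearchProg_le (M : Fin n → Fin n → K) (α : Finset (Fin n))
    (x : Fin n → K) :
    (reductionSearchProg M α x).steps ≤ n * (1 + (reduceSteps n + n * 4)) := by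
  refine steps_firstSome_le fun i => ?_
  have h1 := steps_reduceProg_le M α x i
  have h2 := steps_nonzeroProg_le (reduceProg M α x i).run
  split_ifs
  · simp only [bind_eq, pure_eq, steps_bind]
    split_ifs <;> simp only [steps_ret] <;> omega
  · simp [steps_ret]

theorem steps_recursiveFindProg_le (M : Fin n → Fin n → K) (t : ℕ) (α : Finset (Fin n))
    (x : Fin n → K) : (recursiveFindProg M t α x).steps ≤ t * callSteps n := by
  induction t generalizing α x with
  | zero => simp [recursiveFindProg, steps_ret]
  | succ t ih =>
    have h1 := steps_scanProg_le (K := K) (n := n)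
    have h2 := steps_minorNonposProg_le M α
    have h3 := steps_minorSearchProg_le M α
    have h4 := steps_reductionSearchProg_le M α x
    rw [add_mul, one_mul]
    rw [recursiveFindProg_succ, steps_bind]
    -- Shields the budget of the deeper calls from the unfolding of `callSteps`.
    generalize ht : t * callSteps n = T at ih ⊢
    rw [callSteps]
    split_ifs
    · rw [steps_ret]
      omega
    rw [steps_bind]
    split_ifs
    · rw [steps_ret]
      omega
    rw [steps_bind]
    cases (minorSearchProg M α).run with
    | some γ =>
      simp only [steps_ret]
      omega
    | none =>
      simp only [steps_bind]
      cases (reductionSearchProg M α x).run with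
      | none =>
        simp only [steps_ret]
        omega
      | some y =>
        have h5 := steps_psuppProg_le y
        have h6 := ih (psuppProg y).run y
        simp only [steps_bind]
        omega

theorem steps_findNonpositiveMinorProg_le (M : Fin n → Fin n → K) (x : Fin n → K) :
    (findNonpositiveMinorProg M x).steps ≤ totalSteps n :=
  steps_recursiveFindProg_le M n Finset.univ x

end Steps

/-! ### Bit lengths, and boxes of rationals -/

section BitLength

theorem bitLength_natCast (k : ℕ) : bitLength (k : ℚ) = k.size + 2 := by
  simp [bitLength]

theorem size_mul_le (a b : ℕ) : (a * b).size ≤ a.size + b.size := by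
  rw [Nat.size_le, pow_add]
  exact Nat.mul_lt_mul'' a.lt_size_self b.lt_size_self

theorem size_le_of_dvd_mul {a b c : ℕ} (h : a ∣ b * c) (h0 : b * c ≠ 0) :
    a.size ≤ b.size + c.size :=
  (Nat.size_le_size (Nat.le_of_dvd (Nat.pos_of_ne_zero h0) h)).trans (size_mul_le b c)

/-- Passing to lowest terms only divides numerator and denominator. The factor 2 is slack. -/
theorem bitLength_mul_le (a b : ℚ) : bitLength (a * b) ≤ 2 * (bitLength a + bitLength b) := by
  have h1 : (a * b).den.size ≤ a.den.size + b.den.size :=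
    size_le_of_dvd_mul (Rat.mul_den_dvd a b) (mul_ne_zero a.den_nz b.den_nz)
  have h2 : (a * b).num.natAbs.size ≤ a.num.natAbs.size + b.num.natAbs.size := by
    rcases eq_or_ne (a * b) 0 with h | h
    · simp [h]
    have hdvd := Rat.num_dvd (a.num * b.num) (b := a.den * b.den) (by simp)
    have hab : Rat.divInt (a.num * b.num) (a.den * b.den) = a * b := by
      rw [← Rat.divInt_mul_divInt, Rat.num_divInt_den, Rat.num_divInt_den]
    rw [hab] at hdvd
    have := Int.natAbs_dvd_natAbs.mpr hdvd
    rw [Int.natAbs_mul] at this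
    refine size_le_of_dvd_mul this ?_
    simpa using h
  simp only [bitLength]
  omega

theorem bitLength_inv (a : ℚ) : bitLength a⁻¹ = bitLength a := by
  rcases eq_or_ne a 0 with rfl | h
  · simp
  · have h1 : a⁻¹.num.natAbs = a.den := by
      rw [Rat.num_inv, Int.natAbs_mul, Int.natAbs_sign_of_ne_zero (by simpa using h)]
      simp
    have h2 : a⁻¹.den = a.num.natAbs := by
      rw [Rat.den_inv, if_neg (by simpa using h)]
    rw [bitLength, bitLength, h1, h2]
    omega

theorem bitLength_div_le (a b : ℚ) : bitLength (a / b) ≤ 2 * (bitLength a + bitLength b) := by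
  rw [div_eq_mul_inv, ← bitLength_inv b]
  exact bitLength_mul_le a b⁻¹

/-- `r` has a denominator dividing `E` and absolute value at most `G`. -/
def InBox (E G : ℕ) (r : ℚ) : Prop := r.den ∣ E ∧ |r| ≤ G

variable {E E' G G' : ℕ} {r s : ℚ}

theorem InBox.mono (h : InBox E G r) (hE : E ∣ E') (hG : G ≤ G') : InBox E' G' r :=
  ⟨h.1.trans hE, h.2.trans (Nat.cast_le.mpr hG)⟩

theorem inBox_natCast {k : ℕ} (h : k ≤ G) : InBox E G (k : ℚ) :=
  ⟨by simp, by simpa using h⟩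

theorem inBox_zero : InBox E G 0 := by simp [InBox]

/-- Addition does not enlarge the common denominator. This is the gain over bit lengths, for which
long sums would be costly. -/
theorem InBox.add (hr : InBox E G r) (hs : InBox E G' s) : InBox E (G + G') (r + s) :=
  ⟨(Rat.add_den_dvd_lcm r s).trans (Nat.lcm_dvd hr.1 hs.1),
    (abs_add_le r s).trans (by push_cast; exact add_le_add hr.2 hs.2)⟩

theorem InBox.neg (hr : InBox E G r) : InBox E G (-r) := by
  simpa [InBox] using hr

theorem InBox.mul (hr : InBox E G r) (hs : InBox E' G' s) : InBox (E * E') (G * G') (r * s) :=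
  ⟨(Rat.mul_den_dvd r s).trans (mul_dvd_mul hr.1 hs.1), by
    rw [abs_mul]
    push_cast
    exact mul_le_mul hr.2 hs.2 (abs_nonneg _) (Nat.cast_nonneg _)⟩

theorem InBox.div_natCast (hr : InBox E G r) {k : ℕ} (hk : 0 < k) : InBox (E * k) G (r / k) := by
  have h : InBox k 1 ((k : ℚ)⁻¹) := by
    refine ⟨by rw [Rat.den_inv]; split_ifs <;> simp, ?_⟩
    rw [abs_of_nonneg (by positivity), Nat.cast_one]
    exact inv_le_one_of_one_le₀ (by exact_mod_cast hk)
  simpa [div_eq_mul_inv] using hr.mul h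

theorem InBox.sum {ι : Type} {f : ι → ℚ} (hf : ∀ i, InBox E G (f i)) (T : Finset ι) :
    InBox E (T.card * G) (∑ i ∈ T, f i) := by
  classical
  induction T using Finset.induction_on with
  | empty => simp [inBox_zero]
  | insert a T ha ih =>
    rw [Finset.sum_insert ha, Finset.card_insert_of_notMem ha, add_mul, one_mul,
      add_comm (_ * _)]
    exact (hf a).add ih

theorem InBox.sum_fin {n : ℕ} {f : Fin n → ℚ} (hf : ∀ i, InBox E G (f i)) (T : Finset (Fin n)) :
    InBox E (n * G) (∑ i ∈ T, f i) :=
  (InBox.sum hf T).mono dvd_rfl (Nat.mul_le_mul_right _ (by simpa using T.card_le_univ))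

/-- A number in a box is an integer, of bounded absolute value, divided by `E`. -/
theorem InBox.exists_int (h : InBox E G r) : ∃ z : ℤ, r * E = z ∧ z.natAbs ≤ E * G := by
  obtain ⟨c, hc⟩ := h.1
  have hz : r * E = (r.num * c : ℤ) := by
    rw [hc]
    push_cast
    rw [← mul_assoc, Rat.mul_den_eq_num]
  refine ⟨_, hz, ?_⟩
  have : ((r.num * c : ℤ).natAbs : ℚ) ≤ (E * G : ℕ) := by
    rw [Nat.cast_natAbs, Int.cast_abs, ← hz, abs_mul, Nat.abs_cast, mul_comm]
    push_cast
    exact mul_le_mul_of_nonneg_left h.2 (Nat.cast_nonneg _)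
  exact_mod_cast this

/-- The numerator is at most 2^(a + b) and the denominator at most 2^a. Their sizes are at most a +
b + 1 and a + 1, and one more bit is the sign. -/
theorem InBox.bitLength_le (h : InBox E G r) (hE : E ≠ 0) {a b : ℕ} (ha : E ≤ 2 ^ a)
    (hb : G ≤ 2 ^ b) : bitLength r ≤ 2 * a + b + 3 := by
  have hden : r.den ≤ 2 ^ a := (Nat.le_of_dvd (Nat.pos_of_ne_zero hE) h.1).trans ha
  have hnum : r.num.natAbs ≤ 2 ^ (a + b) := by
    have : (r.num.natAbs : ℚ) ≤ (2 ^ a * 2 ^ b : ℕ) := by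
      rw [Nat.cast_natAbs, Int.cast_abs, ← Rat.mul_den_eq_num, abs_mul, Nat.abs_cast, mul_comm]
      push_cast
      exact mul_le_mul (by exact_mod_cast hden) (h.2.trans (by exact_mod_cast hb))
        (abs_nonneg _) (by positivity)
    rw [pow_add]
    exact_mod_cast this
  have h1 := Nat.size_le_size hden
  have h2 := Nat.size_le_size hnum
  rw [Nat.size_pow] at h1 h2
  rw [bitLength]
  omega

end BitLength

/-- All numbers loaded or used by the instruction satisfy `P`. -/
def Instr.On (P : ℚ → Prop) : (β : Type) → Instr ℚ β → Prop
  | _, .lit k => P k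
  | _, .arith _ a b => P a ∧ P b
  | _, .le a b => P a ∧ P b
  | _, .tick => True
  | _, .enterDet => True

theorem Instr.bitWeight_le {S : ℕ} (β : Type) (i : Instr ℚ β)
    (h : i.On (fun r => bitLength r ≤ S)) : i.bitWeight ≤ (S + S) ^ 2 + 1 := by
  cases i with
  | lit k =>
    simp only [Instr.On, bitLength_natCast] at h
    simp only [Instr.bitWeight]
    nlinarith
  | arith o a b =>
    simp only [Instr.On] at h
    exact (Nat.pow_le_pow_left (add_le_add h.1 h.2) 2).trans (Nat.le_succ _)
  | le a b =>
    simp only [Instr.On] at h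
    exact (Nat.pow_le_pow_left (add_le_add h.1 h.2) 2).trans (Nat.le_succ _)
  | tick => simp [Instr.bitWeight]
  | enterDet => simp [Instr.bitWeight]

theorem Prog.All.mono {P Q : ℚ → Prop} (hPQ : ∀ r, P r → Q r) {α : Type} {p : Prog ℚ α}
    (h : p.All (Instr.On P)) : p.All (Instr.On Q) := by
  induction p with
  | ret a => trivial
  | exec i next ih =>
    refine ⟨?_, ih _ h.2⟩
    have h1 := h.1
    cases i <;> simp only [Instr.On] at h1 ⊢
    exacts [hPQ _ h1, ⟨hPQ _ h1.1, hPQ _ h1.2⟩, ⟨hPQ _ h1.1, hPQ _ h1.2⟩]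

/-! ### Size of the numbers in the Faddeev–LeVerrier rounds -/

section LeVerrier

open scoped Nat

/-- A common denominator of the numbers of the Faddeev–LeVerrier method. -/
def leverrierDen (D n : ℕ) : ℕ := D ^ n * n !

/-- A bound for the numbers of the Faddeev–LeVerrier method. -/
def leverrierBound (n H m : ℕ) : ℕ := (2 * n ^ 2 * H) ^ m

variable {n D H : ℕ} {B : Matrix (Fin n) (Fin n) ℚ}

theorem leverrierDen_dvd {m k : ℕ} (h : m ≤ k) : leverrierDen D m ∣ leverrierDen D k :=
  mul_dvd_mul (pow_dvd_pow D h) (Nat.factorial_dvd_factorial h)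

/-- One factor n comes from an entry of the product and one from the trace. The factor 2 left over
in the bound pays for adding c. -/
theorem le_leverrierBound_succ (m : ℕ) :
    n * (n * (H * leverrierBound n H m)) ≤ leverrierBound n H (m + 1) := by
  have h : leverrierBound n H (m + 1) = 2 * (n * (n * (H * leverrierBound n H m))) := by
    rw [leverrierBound, leverrierBound, pow_succ]
    ring
  omega

theorem leverrierBound_mono (hn : 0 < n) (hH : 0 < H) {m k : ℕ} (h : m ≤ k) :
    leverrierBound n H m ≤ leverrierBound n H k :=
  Nat.pow_le_pow_right (by positivity) h

theorem inBox_mul_of_inBox (hB : ∀ i j, InBox D H (B i j)) {N : Matrix (Fin n) (Fin n) ℚ} {m : ℕ}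
    (hN : ∀ i j, InBox (leverrierDen D m) (leverrierBound n H m) (N i j)) (i l j : Fin n) :
    InBox (D ^ (m + 1) * m !) (H * leverrierBound n H m) (B i l * N l j) := by
  have := (hB i l).mul (hN l j)
  rwa [leverrierDen, ← mul_assoc, ← pow_succ'] at this

/-- Round m + 1 multiplies once by B and divides only by m + 1, so the denominators divide D^(m + 1)
(m + 1)!. -/
theorem inBox_leverrierMatrix (hB : ∀ i j, InBox D H (B i j)) (m : ℕ) (i j : Fin n) :
    InBox (leverrierDen D m) (leverrierBound n H m) (leverrierMatrix B m i j) := by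
  induction m generalizing i j with
  | zero =>
    rw [leverrierMatrix_zero, Matrix.one_apply]
    split_ifs
    · exact_mod_cast inBox_natCast (k := 1) (by simp [leverrierBound])
    · exact inBox_zero
  | succ m ih =>
    have hn : 1 ≤ n := i.pos
    have h1 (i j : Fin n) : InBox (D ^ (m + 1) * m !) (n * (H * leverrierBound n H m))
        ((B * leverrierMatrix B m) i j) := by
      rw [Matrix.mul_apply]
      exact InBox.sum_fin (fun l => inBox_mul_of_inBox hB ih i l j) _
    have hden : D ^ (m + 1) * m ! * (m + 1) = leverrierDen D (m + 1) := by
      rw [leverrierDen, Nat.factorial_succ]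
      ring
    have h2 : InBox (leverrierDen D (m + 1)) (n * (n * (H * leverrierBound n H m)))
        (leverrierScalar B (m + 1)) := by
      rw [leverrierScalar_succ, zero_sub, ← hden]
      exact (InBox.sum_fin (fun i => h1 i i) _).neg.div_natCast m.succ_pos
    have h3 := (h1 i j).mono (hden ▸ dvd_mul_right _ _) le_rfl
    have h4 : n * (H * leverrierBound n H m) + n * (n * (H * leverrierBound n H m)) ≤
        leverrierBound n H (m + 1) := by
      have h5 : n * (H * leverrierBound n H m) ≤ n * (n * (H * leverrierBound n H m)) :=
        Nat.le_mul_of_pos_left _ hn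
      have h6 : leverrierBound n H (m + 1) = 2 * (n * (n * (H * leverrierBound n H m))) := by
        rw [leverrierBound, leverrierBound, pow_succ]
        ring
      omega
    rw [leverrierMatrix_succ, Matrix.add_apply]
    by_cases hij : i = j
    · subst hij
      simpa using (h3.add h2).mono dvd_rfl h4
    · simpa [hij] using h3.mono dvd_rfl ((Nat.le_add_right _ _).trans h4)

theorem inBox_leverrierScalar (hB : ∀ i j, InBox D H (B i j)) (m : ℕ) :
    InBox (leverrierDen D m) (leverrierBound n H m) (leverrierScalar B m) := by
  cases m with
  | zero =>
    rw [leverrierScalar_zero]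
    exact_mod_cast inBox_natCast (k := 1) (by simp [leverrierBound])
  | succ m =>
    have hden : D ^ (m + 1) * m ! * (m + 1) = leverrierDen D (m + 1) := by
      rw [leverrierDen, Nat.factorial_succ]
      ring
    rw [leverrierScalar_succ, zero_sub, ← hden]
    refine ((InBox.sum_fin (fun i => ?_) _).neg.mono dvd_rfl
      (le_leverrierBound_succ m)).div_natCast m.succ_pos
    rw [Matrix.diag_apply, Matrix.mul_apply]
    exact InBox.sum_fin (fun l => inBox_mul_of_inBox hB (inBox_leverrierMatrix hB m) i l i) _

/-- The number lies in the box that contains all numbers of the Faddeev–LeVerrier method. -/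
def InLeverrierBox (n D H : ℕ) : ℚ → Prop := InBox (leverrierDen D n) (leverrierBound n H n)

theorem inLeverrierBox_natCast (hH : 0 < H) {k : ℕ} (hk : k ≤ n) : InLeverrierBox n D H k := by
  refine inBox_natCast ?_
  rcases Nat.eq_zero_or_pos n with rfl | hn
  · omega
  · have h1 := leverrierBound_mono hn hH hn
    have h2 : leverrierBound n H 1 = 2 * n ^ 2 * H := pow_one _
    nlinarith [Nat.mul_le_mul hn (Nat.mul_le_mul hn hH)]

theorem inLeverrierBox_one (hH : 0 < H) : InLeverrierBox n D H 1 := by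
  rcases Nat.eq_zero_or_pos n with rfl | hn
  · exact_mod_cast inBox_natCast (k := 1) (by simp [leverrierBound])
  · exact_mod_cast inLeverrierBox_natCast (k := 1) hH hn

theorem inLeverrierBox_zero : InLeverrierBox n D H 0 := inBox_zero

theorem InBox.inLeverrierBox (hH : 0 < H) {m : ℕ} (hm : m ≤ n) {r : ℚ}
    (h : InBox (leverrierDen D m) (leverrierBound n H m) r) : InLeverrierBox n D H r := by
  rcases Nat.eq_zero_or_pos n with rfl | hn
  · obtain rfl : m = 0 := by omega
    exact h
  · exact h.mono (leverrierDen_dvd hm) (leverrierBound_mono hn hH hm)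

/-- Products, partial sums and traces formed in a round already obey the bound of the following
matrix; boxes grow with the round, so the last one contains them all. -/
theorem all_leverrier (hH : 0 < H) (hB : ∀ i j, InBox D H (B i j)) {m : ℕ} (hm : m ≤ n) :
    (leverrier (Matrix.of.symm B) m).All (Instr.On (InLeverrierBox n D H)) := by
  induction m with
  | zero =>
    simp only [leverrier, bind_eq, pure_eq, all_bind, all_instr, all_ret, and_true]
    refine ⟨all_tabulate trivial _ _ fun i => all_tabulate trivial _ _ fun j => ?_, ?_⟩
    · split_ifs
      · simpa [Instr.On] using inLeverrierBox_one hH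
      · simpa [Instr.On] using inLeverrierBox_zero
    · simpa [Instr.On] using inLeverrierBox_one hH
  | succ m ih =>
    have hn : 0 < n := by omega
    have hN (i j : Fin n) : InLeverrierBox n D H ((leverrier (Matrix.of.symm B) m).run.1 i j) :=
      (inBox_leverrierMatrix hB m i j).inLeverrierBox hH (by omega)
    have hBE (i j : Fin n) : InLeverrierBox n D H (B i j) := by
      refine InBox.inLeverrierBox (m := 1) hH hn ((hB i j).mono (by simp [leverrierDen]) ?_)
      rw [leverrierBound, pow_one]
      nlinarith [Nat.mul_le_mul hn hn]
    have hdvd : D ^ (m + 1) * m ! ∣ leverrierDen D n :=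
      mul_dvd_mul (pow_dvd_pow D hm) (Nat.factorial_dvd_factorial (by omega))
    have hle : n * (n * (H * leverrierBound n H m)) ≤ leverrierBound n H n :=
      (le_leverrierBound_succ m).trans (leverrierBound_mono hn hH hm)
    have hle1 : n * (H * leverrierBound n H m) ≤ leverrierBound n H n :=
      (Nat.le_mul_of_pos_left _ hn).trans hle
    have hle0 : H * leverrierBound n H m ≤ leverrierBound n H n :=
      (Nat.le_mul_of_pos_left _ hn).trans hle1
    have hterm := inBox_mul_of_inBox hB (inBox_leverrierMatrix hB m)
    have hP (i j : Fin n) : InBox (D ^ (m + 1) * m !) (n * (H * leverrierBound n H m))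
        ((B * leverrierMatrix B m) i j) := by
      rw [Matrix.mul_apply]
      exact InBox.sum_fin (fun l => hterm i l j) _
    have hrun : (mulProg (Matrix.of.symm B) (leverrier (Matrix.of.symm B) m).run.1).run =
        fun i j => (B * leverrierMatrix B m) i j := run_mulProg_leverrier B m
    have hc : InLeverrierBox n D H ((0 - ∑ i, (B * leverrierMatrix B m) i i) / (m + 1 : ℕ)) := by
      have := (inBox_leverrierScalar hB (m + 1)).inLeverrierBox hH hm
      rwa [leverrierScalar_succ] at this
    have htr (T : Finset (Fin n)) :
        InLeverrierBox n D H (∑ i ∈ T, (B * leverrierMatrix B m) i i) :=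
      (InBox.sum_fin (fun i => hP i i) T).mono hdvd hle
    simp only [leverrier, bind_eq, pure_eq, all_bind, all_instr, all_ret, and_true, run_sumProg,
      run_instr, Instr.eval, Nat.cast_zero, hrun, run_ret]
    refine ⟨ih (by omega), ?_, ?_, ?_, ?_, ?_, ?_, ?_⟩
    · refine all_tabulate trivial _ _ fun i => all_tabulate trivial _ _ fun j =>
        all_sumProg trivial ?_ _ _ (fun l => ?_) fun l T => ?_
      · simpa [Instr.On] using inLeverrierBox_zero
      · rw [all_instr]
        exact ⟨hBE i l, hN l j⟩
      · exact ⟨(hterm i l j).mono hdvd hle0,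
          (InBox.sum_fin (fun l => hterm i l j) T).mono hdvd hle1⟩
    · refine all_sumProg trivial ?_ _ _ (fun l => trivial) fun l T => ⟨?_, htr T⟩
      · simpa [Instr.On] using inLeverrierBox_zero
      · exact (hP l l).mono hdvd hle1
    · simpa [Instr.On] using inLeverrierBox_zero
    · exact inLeverrierBox_natCast hH hm
    · exact ⟨inLeverrierBox_zero, htr _⟩
    · refine ⟨?_, inLeverrierBox_natCast hH hm⟩
      rw [zero_sub]
      exact (htr Finset.univ).neg
    · refine all_tabulate trivial _ _ fun i => all_tabulate trivial _ _ fun j => ?_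
      split_ifs
      · rw [all_instr]
        exact ⟨(hP i j).mono hdvd hle1, hc⟩
      · trivial

theorem all_detProg (hH : 0 < H) (hB : ∀ i j, InBox D H (B i j)) :
    (detProg (Matrix.of.symm B)).All (Instr.On (InLeverrierBox n D H)) := by
  have h : InLeverrierBox n D H (leverrier (Matrix.of.symm B) n).run.2 :=
    inBox_leverrierScalar hB n
  have h0 : InLeverrierBox n D H ((0 : ℕ) : ℚ) := by simpa using inLeverrierBox_zero
  simp only [detProg, bind_eq, pure_eq, all_bind, all_instr]
  refine ⟨trivial, all_leverrier hH hB le_rfl, ?_⟩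
  split_ifs
  · trivial
  · simp only [all_bind, all_instr]
    exact ⟨h0, h0, h⟩

theorem all_invColProg (hH : 0 < H) (hB : ∀ i j, InBox D H (B i j)) (i : Fin n) :
    (invColProg (Matrix.of.symm B) i).All (Instr.On (InLeverrierBox n D H)) := by
  have h : InLeverrierBox n D H (leverrier (Matrix.of.symm B) n).run.2 :=
    inBox_leverrierScalar hB n
  have h0 : InLeverrierBox n D H ((0 : ℕ) : ℚ) := by simpa using inLeverrierBox_zero
  simp only [invColProg, bind_eq, all_bind, all_instr, run_instr, Instr.eval]
  refine ⟨all_leverrier hH hB (Nat.sub_le n 1), all_leverrier hH hB le_rfl, h0, ⟨h0, h⟩, ?_⟩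
  refine all_tabulate trivial _ _ fun j => ?_
  rw [all_instr]
  refine ⟨(inBox_leverrierMatrix hB (n - 1) j i).inLeverrierBox hH (Nat.sub_le n 1), ?_⟩
  rw [Nat.cast_zero, zero_sub]
  exact h.neg

/-- The computed column of the inverse is a vector in the box, divided by a number in the box. -/
theorem exists_run_invColProg_eq_div (hH : 0 < H) (hB : ∀ i j, InBox D H (B i j)) (i : Fin n) :
    ∃ (u : Fin n → ℚ) (d : ℚ), (∀ j, InLeverrierBox n D H (u j)) ∧ InLeverrierBox n D H d ∧
      (invColProg (Matrix.of.symm B) i).run = fun j => u j / d := by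
  -- Numerators and divisor are kept apart because the common divisor cancels in the elimination.
  refine ⟨fun j => leverrierMatrix B (n - 1) j i, -leverrierScalar B n,
    fun j => (inBox_leverrierMatrix hB (n - 1) j i).inLeverrierBox hH (Nat.sub_le n 1),
    InBox.neg (inBox_leverrierScalar hB n), ?_⟩
  funext j
  change (invColProg B i).run j = _
  simp [invColProg, Instr.eval, leverrierMatrix, leverrierScalar]

end LeVerrier

/-- The entries have a common denominator and absolute values bounded by `2 ^ s`. -/
def VecBound {n : ℕ} (s : ℕ) (x : Fin n → ℚ) : Prop :=
  ∃ E : ℕ, 0 < E ∧ E ≤ 2 ^ s ∧ ∀ j, InBox E (2 ^ s) (x j)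

/-! ### Growth of the vectors under elimination -/

section Growth

variable {n : ℕ} {s t : ℕ} {x : Fin n → ℚ}

theorem VecBound.mono (h : VecBound s x) (hst : s ≤ t) : VecBound t x := by
  obtain ⟨E, hE0, hE, hx⟩ := h
  have hp : 2 ^ s ≤ 2 ^ t := Nat.pow_le_pow_right two_pos hst
  exact ⟨E, hE0, hE.trans hp, fun j => (hx j).mono dvd_rfl hp⟩

theorem VecBound.bitLength_le (h : VecBound s x) (j : Fin n) : bitLength (x j) ≤ 3 * s + 3 := by
  obtain ⟨E, hE0, hE, hx⟩ := h
  have := (hx j).bitLength_le hE0.ne' hE le_rfl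
  omega

/-- Eliminating an entry with the help of a vector whose entries lie in a box. -/
theorem VecBound.sub_div_mul {E G e : ℕ} (hEG : E * G ≤ 2 ^ e) (hE : 0 < E)
    (h : VecBound s x) {u : Fin n → ℚ} (hu : ∀ j, InBox E G (u j)) {d : ℚ} {i : Fin n}
    (hi : u i / d ≠ 0) :
    VecBound (s + e + 1) fun j => x j - x i / (u i / d) * (u j / d) := by
  obtain ⟨F, hF0, hF, hx⟩ := h
  obtain ⟨b, hb, hbE⟩ := (hu i).exists_int
  have hd : d ≠ 0 := fun h => hi (by rw [h, div_zero])
  have hui : u i ≠ 0 := fun h => hi (by rw [h, zero_div])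
  have hE' : (E : ℚ) ≠ 0 := by positivity
  have hb0 : b ≠ 0 := by
    rintro rfl
    simp [hui, hE'] at hb
  -- Clearing E turns u_j / u_i into a quotient a / b of integers bounded by E G. The integer b does
  -- not depend on j, so it serves as denominator for all j at once.
  have hratio (j : Fin n) : InBox b.natAbs (E * G) (u j / u i) := by
    obtain ⟨a, ha, haE⟩ := (hu j).exists_int
    have hab : u j / u i = Rat.divInt a b := by
      rw [Rat.divInt_eq_div, ← ha, ← hb, mul_div_mul_right _ _ hE']
    refine ⟨?_, ?_⟩
    · rw [hab]
      simpa using Int.natAbs_dvd_natAbs.mpr (Rat.den_dvd a b)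
    · rw [hab, Rat.divInt_eq_div, abs_div]
      have h1 : (1 : ℚ) ≤ |(b : ℚ)| := by exact_mod_cast Int.one_le_abs hb0
      refine (div_le_self (abs_nonneg _) h1).trans ?_
      rw [← Int.cast_abs, ← Nat.cast_natAbs]
      exact_mod_cast haE
  refine ⟨F * b.natAbs, Nat.mul_pos hF0 (Int.natAbs_pos.mpr hb0), ?_, fun j => ?_⟩
  · calc F * b.natAbs ≤ 2 ^ s * 2 ^ e := Nat.mul_le_mul hF (hbE.trans hEG)
      _ = 2 ^ (s + e) := (pow_add _ _ _).symm
      _ ≤ 2 ^ (s + e + 1) := Nat.pow_le_pow_right two_pos (Nat.le_succ _)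
  · have h1 : x i / (u i / d) * (u j / d) = x i * (u j / u i) := by field_simp
    beta_reduce
    rw [h1, sub_eq_add_neg]
    refine (((hx j).mono (dvd_mul_right _ _) le_rfl).add ((hx i).mul (hratio j)).neg).mono
      dvd_rfl ?_
    have h2 : 2 ^ s * (E * G) ≤ 2 ^ s * 2 ^ e := Nat.mul_le_mul_left _ hEG
    have h3 : 2 ^ s * 1 ≤ 2 ^ s * 2 ^ e := Nat.mul_le_mul_left _ Nat.one_le_two_pow
    -- The extra bit pays for the sum of two terms.
    have h4 : 2 ^ (s + e + 1) = 2 * (2 ^ s * 2 ^ e) := by ring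
    omega

end Growth

/-! ### Size of all numbers in the procedure -/

section Bits

variable {n D H : ℕ} {M : Fin n → Fin n → ℚ} {α : Finset (Fin n)}

theorem inBox_padded (hH : 0 < H) (hM : ∀ i j, InBox D H (M i j)) (i j : Fin n) :
    InBox D H (padded (Matrix.of M) α i j) := by
  simp only [padded, Matrix.of_apply]
  split_ifs
  exacts [hM i j, by exact_mod_cast inBox_natCast (k := 1) hH, inBox_zero]

theorem all_padProg {P : ℚ → Prop} (h0 : P 0) (h1 : P 1) :
    (padProg M α).All (Instr.On P) := by
  refine all_tabulate trivial _ _ fun i => all_tabulate trivial _ _ fun j => ?_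
  split_ifs
  · trivial
  · simpa [Instr.On] using h1
  · simpa [Instr.On] using h0

theorem all_minorNonposProg (hH : 0 < H) (hM : ∀ i j, InBox D H (M i j)) :
    (minorNonposProg M α).All (Instr.On (InLeverrierBox n D H)) := by
  have h := inBox_leverrierScalar (inBox_padded (α := α) hH hM) n
  have h0 : InLeverrierBox n D H ((0 : ℕ) : ℚ) := by simpa using inLeverrierBox_zero
  -- The determinant is an operand of the final comparison; it is the number c of round n up to
  -- sign, hence in the box.
  have hd := run_detProg (padded (Matrix.of M) α)
  rw [Matrix.det_eq_sign_charpoly_coeff, Fintype.card_fin] at hd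
  have hc := (leverrier_eq (padded (Matrix.of M) α) le_rfl).2
  rw [Nat.sub_self] at hc
  simp only [minorNonposProg, bind_eq, all_bind, all_instr]
  rw [run_padProg]
  refine ⟨all_padProg inLeverrierBox_zero (inLeverrierBox_one hH),
    all_detProg hH (inBox_padded hH hM), h0, ?_, h0⟩
  rw [hd, ← hc]
  rcases neg_one_pow_eq_or ℚ n with hs | hs <;> rw [hs]
  · rw [one_mul]
    exact h
  · rw [neg_one_mul]
    exact h.neg

/-- The running minimum is always one of the ratios, so nothing new is created. -/
theorem all_minRatioProg {P : ℚ → Prop} (h0 : P 0) (k : ℕ) {x b : Fin k → ℚ}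
    (hx : ∀ j, P (x j)) (hb : ∀ j, P (b j)) (hxb : ∀ j, P (x j / b j)) :
    (minRatioProg k x b).All (Instr.On P) := by
  induction k with
  | zero => trivial
  | succ k ih =>
    have h0' : P ((0 : ℕ) : ℚ) := by simpa using h0
    have hs := (run_minRatioProg_spec k (fun j => x j.succ) fun j => b j.succ).2
    simp only [minRatioProg, bind_eq, pure_eq, all_bind, all_instr]
    refine ⟨trivial, ih (fun j => hx _) (fun j => hb _) (fun j => hxb _), h0', ⟨hb 0, h0'⟩, ?_⟩
    split_ifs
    · trivial
    · simp only [all_bind, all_instr]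
      refine ⟨⟨hx 0, hb 0⟩, ?_⟩
      cases hm : (minRatioProg k (fun j => x j.succ) fun j => b j.succ).run with
      | none => trivial
      | some s =>
        obtain ⟨j, -, rfl⟩ := (hs s hm).1
        simp only [all_bind, all_instr]
        refine ⟨⟨hxb 0, hxb _⟩, ?_⟩
        split_ifs <;> trivial

variable {e S₀ S₁ : ℕ} {x : Fin n → ℚ}

/-- A bound for the bit lengths of all numbers used by the procedure, in terms of those of the
numbers of the Faddeev–LeVerrier method and of the vectors. -/
def numberBound (S₀ S₁ : ℕ) : ℕ := 2 * (2 * (S₁ + 4 * S₀) + 4 * S₀)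

theorem all_reduceProg (hH : 0 < H) (hM : ∀ i j, InBox D H (M i j))
    (hS₀ : ∀ r, InLeverrierBox n D H r → bitLength r ≤ S₀)
    (hx : ∀ j, bitLength (x j) ≤ S₁) (i : Fin n) :
    (reduceProg M α x i).All (Instr.On fun r => bitLength r ≤ numberBound S₀ S₁) := by
  have hle : S₀ ≤ numberBound S₀ S₁ := by simp only [numberBound]; omega
  have hbox (r : ℚ) (hr : InLeverrierBox n D H r) : bitLength r ≤ numberBound S₀ S₁ :=
    (hS₀ r hr).trans hle
  have h0 := hS₀ 0 inLeverrierBox_zero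
  obtain ⟨u, d, hu, hd, hb⟩ := exists_run_invColProg_eq_div hH (inBox_padded (α := α) hH hM) i
  -- Three operations in a row: u_j / d costs 4 S₀ bits, the ratio θ costs 2 (S₁ + 4 S₀), and their
  -- product `numberBound`.
  have hbj (j : Fin n) : bitLength (u j / d) ≤ 4 * S₀ := by
    have h1 := bitLength_div_le (u j) d
    have h2 := hS₀ _ (hu j)
    have h3 := hS₀ _ hd
    omega
  have hxb (j : Fin n) : bitLength (x j / (u j / d)) ≤ 2 * (S₁ + 4 * S₀) := by
    have h1 := bitLength_div_le (x j) (u j / d)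
    have h2 := hx j
    have h3 := hbj j
    omega
  have htab (θ : ℚ) (hθ : bitLength θ ≤ 2 * (S₁ + 4 * S₀)) :
      (tabulate n fun j => (instr (.arith .mul θ (u j / d))).bind fun p =>
        instr (.arith .sub (x j) p)).All
          (Instr.On fun r => bitLength r ≤ numberBound S₀ S₁) := by
    refine all_tabulate trivial _ _ fun j => ?_
    have h1 := bitLength_mul_le θ (u j / d)
    have h2 := hbj j
    have h3 := hx j
    simp only [all_bind, all_instr, Instr.On, run_instr, Instr.eval]
    simp only [numberBound]
    omega
  simp only [reduceProg, bind_eq, pure_eq, all_bind]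
  rw [run_padProg, hb]
  refine ⟨all_padProg (hbox _ inLeverrierBox_zero) (hbox _ (inLeverrierBox_one hH)),
    (all_invColProg hH (inBox_padded hH hM) i).mono hbox,
    all_minRatioProg (hbox _ inLeverrierBox_zero) n (fun j => ?_) (fun j => ?_) (fun j => ?_), ?_⟩
  · have := hx j
    simp only [numberBound]
    omega
  · have := hbj j
    simp only [numberBound]
    omega
  · have := hxb j
    simp only [numberBound]
    omega
  · cases hm : (minRatioProg n x fun j => u j / d).run with
    | none =>
      simp only [all_bind, all_instr, run_instr, Instr.eval]
      refine ⟨?_, htab _ ?_⟩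
      · simpa [Instr.On] using hbox 0 inLeverrierBox_zero
      · rw [Nat.cast_zero]
        omega
    | some s =>
      obtain ⟨j, -, rfl⟩ := ((run_minRatioProg_spec n x _).2 s hm).1
      simp only [all_bind, all_ret, run_ret, true_and]
      exact htab _ (hxb j)

/-- The step size is the ratio at some index j with a nonzero column entry, so the result is an
elimination of entry j, independent of d. -/
theorem vecBound_run_reduceProg (hH : 0 < H) (hD : 0 < D) (hM : ∀ i j, InBox D H (M i j))
    (he : leverrierDen D n * leverrierBound n H n ≤ 2 ^ e) {s : ℕ} (hx : VecBound s x)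
    (i : Fin n) : VecBound (s + e + 1) (reduceProg M α x i).run := by
  obtain ⟨u, d, hu, hd, hb⟩ := exists_run_invColProg_eq_div hH (inBox_padded (α := α) hH hM) i
  rw [run_reduceProg_eq, run_padProg, hb]
  cases hm : (minRatioProg n x fun j => u j / d).run with
  | none => simpa using hx.mono (by omega)
  | some r =>
    obtain ⟨j, hj, rfl⟩ := ((run_minRatioProg_spec n x _).2 r hm).1
    have hE : 0 < leverrierDen D n := Nat.mul_pos (Nat.pow_pos hD) n.factorial_pos
    exact hx.sub_div_mul he hE hu hj.ne'

theorem all_nonzeroProg {P : ℚ → Prop} (h0 : P 0) {y : Fin n → ℚ} (hy : ∀ j, P (y j)) :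
    (nonzeroProg y).All (Instr.On P) := by
  have h0' : P ((0 : ℕ) : ℚ) := by simpa using h0
  simp only [nonzeroProg, bind_eq, pure_eq, all_bind, all_ret, and_true]
  refine all_firstSome trivial _ _ fun j => ?_
  simp only [all_bind, all_instr]
  refine ⟨h0', ⟨hy j, h0'⟩, ⟨h0', hy j⟩, ?_⟩
  split_ifs <;> trivial

theorem all_psuppProg {P : ℚ → Prop} (h0 : P 0) {y : Fin n → ℚ} (hy : ∀ j, P (y j)) :
    (psuppProg y).All (Instr.On P) := by
  have h0' : P ((0 : ℕ) : ℚ) := by simpa using h0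
  simp only [psuppProg, bind_eq, pure_eq, all_bind, all_ret, and_true]
  refine all_tabulate trivial _ _ fun j => ?_
  simp only [all_bind, all_instr]
  exact ⟨h0', hy j, h0'⟩

theorem all_scanProg {P : ℚ → Prop} : (scanProg n).All (Instr.On P) := by
  simp only [scanProg, bind_eq, pure_eq, all_bind, all_ret, and_true]
  exact all_tabulate trivial _ _ fun j => trivial

theorem all_minorSearchProg (hH : 0 < H) (hM : ∀ i j, InBox D H (M i j)) :
    (minorSearchProg M α).All (Instr.On (InLeverrierBox n D H)) := by
  refine all_firstSome trivial _ _ fun i => ?_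
  split_ifs
  · simp only [bind_eq, pure_eq, all_bind]
    refine ⟨all_scanProg, all_minorNonposProg hH hM, ?_⟩
    split_ifs <;> trivial
  · trivial

theorem all_reductionSearchProg (hH : 0 < H) (hD : 0 < D) (hM : ∀ i j, InBox D H (M i j))
    (he : leverrierDen D n * leverrierBound n H n ≤ 2 ^ e)
    (hS₀ : ∀ r, InLeverrierBox n D H r → bitLength r ≤ S₀) {s : ℕ} (hx : VecBound s x)
    (hs : 3 * (s + e + 1) + 3 ≤ S₁) :
    (reductionSearchProg M α x).All (Instr.On fun r => bitLength r ≤ numberBound S₀ S₁) := by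
  have h0 := hS₀ 0 inLeverrierBox_zero
  refine all_firstSome trivial _ _ fun i => ?_
  split_ifs
  · simp only [bind_eq, pure_eq, all_bind]
    refine ⟨all_reduceProg hH hM hS₀ (fun j => (hx.bitLength_le j).trans (by omega)) i,
      all_nonzeroProg ?_ fun j => ?_, ?_⟩
    · simp only [numberBound]
      omega
    · have := (vecBound_run_reduceProg (α := α) hH hD hM he hx i).bitLength_le j
      simp only [numberBound]
      omega
    · split_ifs <;> trivial
  · trivial

theorem vecBound_of_run_reductionSearchProg (hH : 0 < H) (hD : 0 < D)
    (hM : ∀ i j, InBox D H (M i j)) (he : leverrierDen D n * leverrierBound n H n ≤ 2 ^ e) {s : ℕ}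
    (hx : VecBound s x) {y : Fin n → ℚ} (hy : (reductionSearchProg M α x).run = some y) :
    VecBound (s + e + 1) y := by
  rw [reductionSearchProg, run_firstSome] at hy
  obtain ⟨i, -, hi⟩ := List.exists_of_findSome?_eq_some hy
  simp only [bind_eq, pure_eq] at hi
  split_ifs at hi
  · simp only [run_bind] at hi
    split_ifs at hi
    · simp only [run_ret, Option.some.injEq] at hi
      exact hi ▸ vecBound_run_reduceProg hH hD hM he hx i
    · simp at hi
  · simp at hi

/-- Each level adds e + 1 to the exponent of the vector bound, so t levels stay within s + t (e +
1). -/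
theorem all_recursiveFindProg (hH : 0 < H) (hD : 0 < D) (hM : ∀ i j, InBox D H (M i j))
    (he : leverrierDen D n * leverrierBound n H n ≤ 2 ^ e)
    (hS₀ : ∀ r, InLeverrierBox n D H r → bitLength r ≤ S₀) (t : ℕ) {s : ℕ} (hx : VecBound s x)
    (hs : 3 * (s + t * (e + 1)) + 3 ≤ S₁) :
    (recursiveFindProg M t α x).All (Instr.On fun r => bitLength r ≤ numberBound S₀ S₁) := by
  have hbox (r : ℚ) (hr : InLeverrierBox n D H r) : bitLength r ≤ numberBound S₀ S₁ := by
    have := hS₀ r hr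
    simp only [numberBound]
    omega
  induction t generalizing α x s with
  | zero => trivial
  | succ t ih =>
    have hs' : 3 * (s + e + 1 + t * (e + 1)) + 3 ≤ S₁ := by
      refine le_trans (le_of_eq ?_) hs
      ring
    rw [recursiveFindProg_succ, all_bind]
    refine ⟨all_scanProg, ?_⟩
    split_ifs
    · trivial
    rw [all_bind]
    refine ⟨(all_minorNonposProg hH hM).mono hbox, ?_⟩
    split_ifs
    · trivial
    rw [all_bind]
    refine ⟨(all_minorSearchProg hH hM).mono hbox, ?_⟩
    cases (minorSearchProg M α).run with
    | some γ => trivial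
    | none =>
      simp only [all_bind]
      refine ⟨all_reductionSearchProg hH hD hM he hS₀ hx (by omega), ?_⟩
      cases hy : (reductionSearchProg M α x).run with
      | none => trivial
      | some y =>
        have hyb := vecBound_of_run_reductionSearchProg hH hD hM he hx hy
        simp only [all_bind]
        refine ⟨all_psuppProg (hbox 0 inLeverrierBox_zero) fun j => ?_, ih hyb hs'⟩
        have := hyb.bitLength_le j
        simp only [numberBound]
        omega

end Bits

/-! ### Bounds in terms of the input length -/

section Input

theorem den_le_two_pow (r : ℚ) : r.den ≤ 2 ^ bitLength r :=
  r.den.lt_size_self.le.trans (Nat.pow_le_pow_right two_pos (by simp only [bitLength]; omega))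

theorem inBox_den (r : ℚ) {s : ℕ} (hs : bitLength r ≤ s) : InBox r.den (2 ^ s) r := by
  refine ⟨dvd_rfl, ?_⟩
  have h1 : |r| ≤ (r.num.natAbs : ℚ) := by
    rw [Nat.cast_natAbs, Int.cast_abs, ← Rat.mul_den_eq_num, abs_mul, Nat.abs_cast]
    exact le_mul_of_one_le_right (abs_nonneg _) (by exact_mod_cast r.den_pos)
  refine h1.trans (Nat.cast_le.mpr (r.num.natAbs.lt_size_self.le.trans
    (Nat.pow_le_pow_right two_pos ?_)))
  simp only [bitLength] at hs
  omega

/-- A finite family of rationals has a common denominator of bit length at most the sum. -/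
theorem exists_common_den {ι : Type} [Fintype ι] (f : ι → ℚ) :
    ∃ E : ℕ, 0 < E ∧ E ≤ 2 ^ (∑ i, bitLength (f i)) ∧
      ∀ i, InBox E (2 ^ ∑ i, bitLength (f i)) (f i) := by
  refine ⟨∏ i, (f i).den, Finset.prod_pos fun i _ => (f i).den_pos, ?_, fun i => ?_⟩
  · rw [← Finset.prod_pow_eq_pow_sum]
    exact Finset.prod_le_prod' fun i _ => den_le_two_pow (f i)
  · refine (inBox_den (f i) (Finset.single_le_sum (f := fun i => bitLength (f i))
      (fun _ _ => Nat.zero_le _) (Finset.mem_univ i))).mono ?_ le_rfl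
    exact Finset.dvd_prod_of_mem (fun i => (f i).den) (Finset.mem_univ i)

variable {n : ℕ} (M : Matrix (Fin n) (Fin n) ℚ) (x : Fin n → ℚ)

theorem le_inputLength : n ≤ inputLength M x := by
  have h : ∑ _i : Fin n, 1 ≤ ∑ i, bitLength (x i) :=
    Finset.sum_le_sum fun i _ => by simp only [bitLength]; omega
  simp only [Finset.sum_const, Finset.card_univ, Fintype.card_fin, smul_eq_mul, mul_one] at h
  exact h.trans (Nat.le_add_left _ _)

theorem vecBound_inputLength : VecBound (inputLength M x) x := by
  obtain ⟨E, h0, h1, h2⟩ := exists_common_den x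
  exact VecBound.mono ⟨E, h0, h1, h2⟩ (Nat.le_add_left _ _)

theorem exists_den_inputLength :
    ∃ D : ℕ, 0 < D ∧ D ≤ 2 ^ inputLength M x ∧ ∀ i j, InBox D (2 ^ inputLength M x) (M i j) := by
  obtain ⟨E, h0, h1, h2⟩ := exists_common_den fun p : Fin n × Fin n => M p.1 p.2
  rw [Fintype.sum_prod_type] at h1 h2
  have hle : 2 ^ (∑ i, ∑ j, bitLength (M i j)) ≤ 2 ^ inputLength M x :=
    Nat.pow_le_pow_right two_pos (Nat.le_add_right _ _)
  exact ⟨E, h0, h1.trans hle, fun i j => (h2 (i, j)).mono dvd_rfl hle⟩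

theorem leverrierDen_le {L D : ℕ} (hn : n ≤ L) (hD : D ≤ 2 ^ L) :
    leverrierDen D n ≤ 2 ^ (2 * (L * L)) := by
  have h1 : D ^ n ≤ 2 ^ (L * L) := by
    rw [pow_mul]
    exact (Nat.pow_le_pow_left hD n).trans (Nat.pow_le_pow_right Nat.one_le_two_pow hn)
  have h2 : n.factorial ≤ 2 ^ (L * L) := by
    rw [pow_mul]
    refine n.factorial_le_pow.trans ((Nat.pow_le_pow_left ?_ n).trans
      (Nat.pow_le_pow_right Nat.one_le_two_pow hn))
    exact hn.trans L.lt_two_pow_self.le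
  rw [two_mul, pow_add]
  exact Nat.mul_le_mul h1 h2

theorem leverrierBound_le {L : ℕ} (hn : n ≤ L) (hL : 0 < L) :
    leverrierBound n (2 ^ L) n ≤ 2 ^ (4 * (L * L)) := by
  have h1 : n ≤ 2 ^ L := hn.trans L.lt_two_pow_self.le
  have h2 : 2 * n ^ 2 * 2 ^ L ≤ 2 ^ (4 * L) := by
    calc 2 * n ^ 2 * 2 ^ L ≤ 2 ^ L * (2 ^ L) ^ 2 * 2 ^ L := by
          gcongr
          exact Nat.le_self_pow hL.ne' 2
      _ = 2 ^ (4 * L) := by ring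
  rw [← mul_assoc, pow_mul]
  exact (Nat.pow_le_pow_left h2 n).trans (Nat.pow_le_pow_right Nat.one_le_two_pow hn)

/-- A bound for the bit lengths of all numbers used by the procedure on an input of length `L`. -/
def numberLength {R : Type} [Semiring R] (L : R) : R :=
  2 * (2 * (3 * (L + L * (6 * (L * L) + 1)) + 3 + 4 * (8 * (L * L) + 3)) +
    4 * (8 * (L * L) + 3))

theorem all_findNonpositiveMinorProg (hn : 0 < n) : (findNonpositiveMinorProg M x).All
    (Instr.On fun r => bitLength r ≤ numberLength (inputLength M x)) := by
  obtain ⟨D, hD0, hD, hM⟩ := exists_den_inputLength M x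
  have hnL := le_inputLength M x
  have hx := vecBound_inputLength M x
  generalize inputLength M x = L at *
  have h1 := leverrierDen_le hnL hD
  have h2 := leverrierBound_le hnL (hn.trans_le hnL)
  have hden : leverrierDen D n ≠ 0 := mul_ne_zero (pow_ne_zero _ hD0.ne') n.factorial_ne_zero
  -- With denominators up to 2^(2L²) and values up to 2^(4L²), e is 2L² + 4L², and S₀ is 2·2L² + 4L²
  -- + 3. The vectors start at exponent L and pass through n ≤ L levels.
  refine all_recursiveFindProg (S₀ := 8 * (L * L) + 3)
    (S₁ := 3 * (L + L * (6 * (L * L) + 1)) + 3) (e := 6 * (L * L)) (by positivity) hD0 hM ?_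
    (fun r hr => ?_) n hx ?_
  · calc _ ≤ 2 ^ (2 * (L * L)) * 2 ^ (4 * (L * L)) := Nat.mul_le_mul h1 h2
      _ = 2 ^ (6 * (L * L)) := by ring
  · have := InBox.bitLength_le hr hden h1 h2
    omega
  · gcongr

theorem bitTime_findNonpositiveMinorProg_le (hn : 0 < n) :
    (findNonpositiveMinorProg M x).bitTime ≤ totalSteps (inputLength M x) *
      ((numberLength (inputLength M x) + numberLength (inputLength M x)) ^ 2 + 1) :=
  (cost_le_steps_mul Instr.bitWeight_le _ (all_findNonpositiveMinorProg M x hn)).trans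
    (Nat.mul_le_mul_right _ ((steps_findNonpositiveMinorProg_le M x).trans
      (totalSteps_mono (le_inputLength M x))))

end Input

end NonposMinor

/-! ### The theorem -/

theorem mainTheorem2 :
    -- correctness and number of determinants
    (∀ (K : Type) [Field K] [LinearOrder K] [IsStrictOrderedRing K] (n : ℕ)
      (M : Matrix (Fin n) (Fin n) K) (x : Fin n → K),
      0 < n → (∀ i, 0 < x i) → (∀ i, M.mulVec x i ≤ 0) →
        (NonposMinor.principal M (NonposMinor.findNonpositiveMinor M x)).det ≤ 0 ∧
        (NonposMinor.findNonpositiveMinorProg M x).run = NonposMinor.findNonpositiveMinor M x ∧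
        2 * (NonposMinor.findNonpositiveMinorProg M x).dets ≤ n * (n + 3)) ∧
    -- the routine whose calls are counted returns the determinant
    (∀ (K : Type) [Field K] [LinearOrder K] [IsStrictOrderedRing K] (n : ℕ)
      (B : Matrix (Fin n) (Fin n) K), (NonposMinor.detProg B).run = B.det) ∧
    -- the reduction step in a recursive call
    (∀ (K : Type) [Field K] [LinearOrder K] [IsStrictOrderedRing K] (n : ℕ)
      (M : Matrix (Fin n) (Fin n) K) (α : Finset (Fin n)) (x : Fin n → K),
      2 ≤ α.card → (∀ i ∈ α, 0 < x i) → (∀ i ∉ α, x i = 0) → (∀ i ∈ α, M.mulVec x i ≤ 0) →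
      0 < (NonposMinor.principal M α).det →
      (∀ i ∈ α, 0 < (NonposMinor.principal M (α.erase i)).det) →
        (∀ i ∈ α, (∀ j, 0 ≤ NonposMinor.reduceOn M α x i j) ∧
          (∀ j ∈ α, M.mulVec (NonposMinor.reduceOn M α x i) j ≤ 0) ∧
          NonposMinor.psupp (NonposMinor.reduceOn M α x i) ⊂ α) ∧
        ∃ i ∈ α, NonposMinor.reduceOn M α x i ≠ 0) ∧
    -- polynomially many arithmetic operations, comparisons and bookkeeping steps
    (∃ p : Polynomial ℕ, ∀ (K : Type) [Field K] [LinearOrder K] [IsStrictOrderedRing K] (n : ℕ)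
      (M : Matrix (Fin n) (Fin n) K) (x : Fin n → K),
      0 < n → (∀ i, 0 < x i) → (∀ i, M.mulVec x i ≤ 0) →
        (NonposMinor.findNonpositiveMinorProg M x).steps ≤ p.eval n) ∧
    -- polynomial bit complexity on rational data
    (∃ p : Polynomial ℕ, ∀ (n : ℕ) (M : Matrix (Fin n) (Fin n) ℚ) (x : Fin n → ℚ),
      0 < n → (∀ i, 0 < x i) → (∀ i, M.mulVec x i ≤ 0) →
        (NonposMinor.findNonpositiveMinorProg M x).bitTime ≤
          p.eval (NonposMinor.inputLength M x)) := by
  -- The polynomials are the explicit bounds taken at X; the second is the number of steps times the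
  -- largest weight.
  refine ⟨?_, ?_, ?_, ⟨NonposMinor.totalSteps Polynomial.X, ?_⟩,
    ⟨NonposMinor.totalSteps Polynomial.X * ((NonposMinor.numberLength Polynomial.X +
      NonposMinor.numberLength Polynomial.X) ^ 2 + 1), ?_⟩⟩
  · intro K _ _ _ n M x hn hx hM
    have h : NonposMinor.Admissible M Finset.univ x :=
      ⟨fun i _ => hx i, fun i hi => absurd (Finset.mem_univ i) hi, fun i _ => hM i⟩
    obtain ⟨β, h1, h2, h3, h4⟩ := NonposMinor.recursiveFind_spec (M := M) n h
      (Finset.univ_nonempty_iff.mpr ⟨⟨0, hn⟩⟩) (by simp)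
    have hβ : NonposMinor.findNonpositiveMinor M x = β := h2
    refine ⟨hβ ▸ h1, hβ ▸ h3, ?_⟩
    rw [Finset.card_univ, Fintype.card_fin] at h4
    exact h4
  · intro K _ _ _ n B
    exact NonposMinor.run_detProg B
  · intro K _ _ _ n M α x hcard hpos hzero hnonpos hdet hminors
    have h : NonposMinor.Admissible M α x := ⟨hpos, hzero, hnonpos⟩
    exact ⟨fun i hi => ⟨h.reduceOn_nonneg hdet.ne' hi, fun j hj => h.mulVec_reduceOn hdet.ne' hi hj,
      h.psupp_reduceOn_ssubset hdet hi (hminors i hi)⟩, h.exists_reduceOn_ne_zero hcard hdet⟩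
  · intro K _ _ _ n M x _ _ _
    rw [NonposMinor.eval_totalSteps]
    exact NonposMinor.steps_findNonpositiveMinorProg_le M x
  · intro n M x hn _ _
    have := NonposMinor.bitTime_findNonpositiveMinorProg_le M x hn
    simpa [NonposMinor.eval_totalSteps, NonposMinor.numberLength] using this
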